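/- All Lie groups are real, smooth, finite-dimensional, Hausdorff and second countable. A \emph{central Lie crossed module} $(\tilde G,H,f,\triangleright)$ consists of Lie groups $\tilde G,H$, a smooth homomorphism $f:H\to\tilde G$ and a smooth left action $\triangleright$ of $\tilde G$ on $H$ by automorphisms, with $f(g\triangleright h)=gf(h)g^{-1}$ and $f(h_1)\triangleright h_2=h_1h_2h_1^{-1}$, such that $G:=\tilde G/\mathrm{Im}(f)$ is a Lie group (with $\pi:\tilde G\to G$ a submersion) and $\tilde G$ acts trivially on $T:=\ker f$. Let $\tilde{\mathfrak g},\mathfrak h,\mathfrak t$ be the Lie algebras of $\tilde G,H,T$, so that $\mathfrak t=\ker(f:\mathfrak h\to\tilde{\mathfrak g})$, where $f$ also denotes the differential of $f$. The associated multiplicative $T$-gerbe $\mathcal G$ over $G$ is the following bundle gerbe over the surjective submersion $\pi:\tilde G\to G$. Its $T$-bundle is $L=\tilde G\times H\to\tilde G\times_G\tilde G$, $(g,h)\mapsto(g,f(h)g)$, where $T$ acts by $(g,h)\cdot t=(g,ht)$. Its gerbe product $p_{12}^*L\otimes p_{23}^*L\to p_{13}^*L$ is $(g,h)\otimes(f(h)g,h')\mapsto(g,h'h)$.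 The multiplication $m:g_1^*\mathcal G\otimes g_2^*\mathcal G\to(g_1g_2)^*\mathcal G$ is given by the bundle isomorphism $(g_1,h_1)\otimes(g_2,h_2)\mapsto(g_1g_2,h_1\cdot(g_1\triangleright h_2))$ over $\tilde G^2\times_{G^2}\tilde G^2$, and its associator is the identity. A \emph{connective structure} on $\mathcal G$ is a pair $(\nabla,\tau)$. Here $\nabla\in\Omega^1(\tilde G\times H,\mathfrak t)$ is a principal $T$-connection on $L$ for which the gerbe product is flat, i.e. $(g,h)^*\nabla+(f(h)g,h')^*\nabla=(g,h'h)^*\nabla$ on $\tilde G\times H\times H$. The form $\tau\in\Omega^1(\tilde G\times\tilde G,\mathfrak t)$ is a connection on $m$, i.e. $$(f(h_1)g_1,f(h_2)g_2)^*\tau-(g_1,g_2)^*\tau=(g_1g_2,h_1\cdot(g_1\triangleright h_2))^*\nabla-(g_1,h_1)^*\nabla-(g_2,h_2)^*\nabla,$$ for which the associator is flat, i.e. $(g_1,g_2)^*\tau+(g_1g_2,g_3)^*\tau=(g_1,g_2g_3)^*\tau+(g_2,g_3)^*\tau$. A morphism $(\nabla_1,\tau_1)\to(\nabla_2,\tau_2)$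 is a connection on the identity isomorphism of the gerbe compatible with the connections on $m$, i.e. a form $\sigma\in\Omega^1(\tilde G,\mathfrak t)$ with $\nabla_2-\nabla_1=(f(h)g)^*\sigma-g^*\sigma$ and $\tau_2-\tau_1=(g_1g_2)^*\sigma-g_1^*\sigma-g_2^*\sigma$; composition is addition of forms. A \emph{strong adjustment} is a pair $(s,\kappa)$, where $s:\mathfrak h\to\mathfrak t$ is a linear splitting of the inclusion $\mathfrak t\to\mathfrak h$ and $\kappa:\tilde G\times\tilde{\mathfrak g}\to\mathfrak t$ is smooth, linear in $\tilde{\mathfrak g}$, and satisfies $$\kappa(g_1g_2,v)=\kappa(g_2,\mathrm{Ad}(g_1^{-1})v)+\kappa(g_1,v),\qquad \kappa(f(h),v)=s(h^{-1}\cdot(v\triangleright h)),\qquad \kappa(g,f(u))=s(g^{-1}\triangleright u-u).$$ Here $h^{-1}\cdot(v\triangleright h)\in\mathfrak h$ is the differential at $x=1$ of $x\mapsto h^{-1}\cdot(x\triangleright h)$ applied to $v$. A morphism $(s_1,\kappa_1)\to(s_2,\kappa_2)$ is a linear map $\phi:\tilde{\mathfrak g}\to\mathfrak t$ with $s_2(u)-s_1(u)=\phi(f(u))$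 and $\kappa_2(g,v)-\kappa_1(g,v)=\phi(\mathrm{Ad}(g^{-1})v-v)$; composition is addition. \textbf{Proposition.} For every central Lie crossed module $(\tilde G,H,f,\triangleright)$ with associated multiplicative gerbe $\mathcal G$, the category of connective structures on $\mathcal G$ is equivalent to the category of strong adjustments on $(\tilde G,H,f,\triangleright)$. -/

import Mathlib

open scoped Manifold ContDiff
open CategoryTheory

set_option linter.unusedSectionVars false

noncomputable section

/-! ### Smooth vector-valued 1-forms -/

section OneForms

variable {EM : Type*} [NormedAddCommGroup EM] [NormedSpace ℝ EM]
  {HM : Type*} [TopologicalSpace HM] (I : ModelWithCorners ℝ EM HM)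
  (M : Type*) [TopologicalSpace M] [ChartedSpace HM M] [IsManifold I ∞ M]
  {EN : Type*} [NormedAddCommGroup EN] [NormedSpace ℝ EN]
  {HN : Type*} [TopologicalSpace HN] (J : ModelWithCorners ℝ EN HN)
  (N : Type*) [TopologicalSpace N] [ChartedSpace HN N] [IsManifold J ∞ N]
  (V : Type*) [NormedAddCommGroup V] [NormedSpace ℝ V]

/-- Smooth `V`-valued 1-forms on `M`: families of linear maps `T_x M → V` such that the resulting
function on the total space of the tangent bundle is smooth. -/
structure OneForm where
  toFun : ∀ x : M, TangentSpace I x →L[ℝ] V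
  smooth : ContMDiff I.tangent 𝓘(ℝ, V) ∞ (fun v : TangentBundle I M => toFun v.1 v.2)

namespace OneForm

variable {I M V}

@[ext]
theorem ext {α β : OneForm I M V} (h : ∀ x, α.toFun x = β.toFun x) : α = β := by
  cases α; cases β
  congr
  funext x
  exact h x

instance : Zero (OneForm I M V) :=
  ⟨{ toFun := fun _ => 0, smooth := contMDiff_const }⟩

instance : Add (OneForm I M V) :=
  ⟨fun α β => { toFun := fun x => α.toFun x + β.toFun x, smooth := α.smooth.add β.smooth }⟩

instance : Neg (OneForm I M V) :=
  ⟨fun α => { toFun := fun x => -α.toFun x, smooth := α.smooth.neg }⟩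

@[simp] theorem zero_toFun (x : M) : (0 : OneForm I M V).toFun x = 0 := rfl
@[simp] theorem add_toFun (α β : OneForm I M V) (x : M) :
    (α + β).toFun x = α.toFun x + β.toFun x := rfl
@[simp] theorem neg_toFun (α : OneForm I M V) (x : M) : (-α).toFun x = -α.toFun x := rfl

instance : AddCommGroup (OneForm I M V) where
  add_assoc a b c := by ext1 x; simp [add_assoc]
  zero_add a := by ext1 x; simp
  add_zero a := by ext1 x; simp
  neg_add_cancel a := by ext1 x; simp
  add_comm a b := by ext1 x; simp [add_comm]
  nsmul := nsmulRec
  zsmul := zsmulRec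

variable {J N}

/-- The pullback `φ^* α`, with `(φ^* α)_x = α_{φ(x)} ∘ dφ_x`. -/
def pullback (φ : C^∞⟮J, N; I, M⟯) (α : OneForm I M V) : OneForm J N V where
  toFun x := (α.toFun (φ x)).comp (mfderiv J I φ x)
  smooth := α.smooth.comp (φ.contMDiff.contMDiff_tangentMap (m := ∞) (by simp))

@[simp] theorem pullback_zero (φ : C^∞⟮J, N; I, M⟯) :
    pullback φ (0 : OneForm I M V) = 0 := rfl

@[simp] theorem pullback_add (φ : C^∞⟮J, N; I, M⟯) (α β : OneForm I M V) :
    pullback φ (α + β) = pullback φ α + pullback φ β := rfl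

end OneForm

end OneForms

/-! ### Central Lie crossed modules -/

section TangentAtOne

variable {E : Type*} [NormedAddCommGroup E] [NormedSpace ℝ E]
  {A : Type*} [TopologicalSpace A] [ChartedSpace E A] [Group A]
  {E' : Type*} [NormedAddCommGroup E'] [NormedSpace ℝ E']
  {A' : Type*} [TopologicalSpace A'] [ChartedSpace E' A'] [Group A']

/-- The differential at the identity `Lie A → Lie A'` of a map of Lie groups preserving the
identity. The Lie algebra of a Lie group is the tangent space at the identity, which is by
definition the model vector space. -/
def tangentAtOne (φ : A → A') (_h : φ 1 = 1) : E →L[ℝ] E' :=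
  mfderiv 𝓘(ℝ, E) 𝓘(ℝ, E') φ 1

/-- The adjoint action `Ad(g)` of a Lie group on its Lie algebra. -/
def lieAd (g : A) : E →L[ℝ] E :=
  tangentAtOne (fun x : A => g * x * g⁻¹) (by simp)

end TangentAtOne

section Main

variable {E : Type*} [NormedAddCommGroup E] [NormedSpace ℝ E]
  {F : Type*} [NormedAddCommGroup F] [NormedSpace ℝ F]
  {B : Type*} [NormedAddCommGroup B] [NormedSpace ℝ B]

/-- Lie crossed modules `(Gt, H, f, ▷)`: here `act g h` is `g ▷ h`. -/
structure LieCrossedModule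
    (Gt : Type*) [TopologicalSpace Gt] [ChartedSpace E Gt] [Group Gt]
    (H : Type*) [TopologicalSpace H] [ChartedSpace F H] [Group H] where
  f : H →* Gt
  smooth_f : ContMDiff 𝓘(ℝ, F) 𝓘(ℝ, E) ∞ f
  act : Gt →* MulAut H
  smooth_act : ContMDiff (𝓘(ℝ, E).prod 𝓘(ℝ, F)) 𝓘(ℝ, F) ∞ (fun p : Gt × H => act p.1 p.2)
  f_act : ∀ g h, f (act g h) = g * f h * g⁻¹
  act_f : ∀ h₁ h₂, act (f h₁) h₂ = h₁ * h₂ * h₁⁻¹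

/-- Central Lie crossed modules: the quotient `Gt / Im f` is a Lie group `G`, that is, `Im f` is
the kernel of a smooth surjective submersion of Lie groups `π : Gt → G`, and the action of `Gt`
(equivalently, of `Gt / Im f`) on `Ker f` is trivial. -/
structure CentralLieCrossedModule
    (Gt : Type*) [TopologicalSpace Gt] [ChartedSpace E Gt] [Group Gt]
    (H : Type*) [TopologicalSpace H] [ChartedSpace F H] [Group H]
    (G : Type*) [TopologicalSpace G] [ChartedSpace B G] [Group G]
    extends LieCrossedModule (E := E) (F := F) Gt H where
  π : Gt →* G
  submersion_π : Manifold.IsSubmersion 𝓘(ℝ, E) 𝓘(ℝ, B) ∞ π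
  surjective_π : Function.Surjective π
  ker_π : π.ker = f.range
  act_ker : ∀ g, ∀ t ∈ f.ker, act g t = t

variable
  {Gt : Type*} [TopologicalSpace Gt] [ChartedSpace E Gt] [Group Gt] [LieGroup 𝓘(ℝ, E) ∞ Gt]
  {H : Type*} [TopologicalSpace H] [ChartedSpace F H] [Group H] [LieGroup 𝓘(ℝ, F) ∞ H]
  {G : Type*} [TopologicalSpace G] [ChartedSpace B G] [Group G]

namespace CentralLieCrossedModule

variable (X : CentralLieCrossedModule (E := E) (F := F) (B := B) Gt H G)

/-- The differential `f : Lie H → Lie Gt`. -/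
def df : F →L[ℝ] E := tangentAtOne X.f (map_one X.f)

/-- The Lie algebra of `T = Ker f`, as a subalgebra of the Lie algebra of `H`. -/
abbrev lieT : Submodule ℝ F := LinearMap.ker (X.df : F →ₗ[ℝ] E)

/-- The action `u ↦ g ▷ u` of `Gt` on the Lie algebra of `H`. -/
def dact (g : Gt) : F →L[ℝ] F := tangentAtOne (X.act g) (map_one (X.act g))

/-- The linear map `v ↦ h⁻¹ · (v ▷ h)` from the Lie algebra of `Gt` to that of `H`: the
differential at the identity of `x ↦ h⁻¹ · (x ▷ h)`. -/
def dactAt (h : H) : E →L[ℝ] F :=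
  tangentAtOne (fun x : Gt => h⁻¹ * X.act x h) (by simp)

/-! ### The multiplicative bundle gerbe of a central Lie crossed module

The `T`-gerbe over `G`, `T = Ker f`, is given by the surjective submersion `π : Gt → G` and the
`T`-bundle `L = Gt × H → Gt ×_G Gt`, `(g, h) ↦ (g, f(h) g)`, on which `T` acts by right
multiplication on `H`. -/

/-- The first component `L → Gt` of the projection of `L`. -/
def src (_X : CentralLieCrossedModule (E := E) (F := F) (B := B) Gt H G)
    : C^∞⟮𝓘(ℝ, E).prod 𝓘(ℝ, F), Gt × H; 𝓘(ℝ, E), Gt⟯ := ⟨fun p => p.1, contMDiff_fst⟩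

/-- The second component `L → Gt` of the projection of `L`. -/
def tgt : C^∞⟮𝓘(ℝ, E).prod 𝓘(ℝ, F), Gt × H; 𝓘(ℝ, E), Gt⟯ :=
  ⟨fun p => X.f p.2 * p.1, (X.smooth_f.comp contMDiff_snd).mul contMDiff_fst⟩

/-- The action of an element `t` of `T` on `L`. -/
def translate (_X : CentralLieCrossedModule (E := E) (F := F) (B := B) Gt H G)
    (t : H) :
    C^∞⟮𝓘(ℝ, E).prod 𝓘(ℝ, F), Gt × H; 𝓘(ℝ, E).prod 𝓘(ℝ, F), Gt × H⟯ :=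
  ⟨fun p => (p.1, p.2 * t), contMDiff_fst.prodMk (contMDiff_snd.mul contMDiff_const)⟩

/-- The map `x ↦ (g, h x)`, whose restriction to `T` is the orbit map of `(g, h) ∈ L`. -/
def orbit (_X : CentralLieCrossedModule (E := E) (F := F) (B := B) Gt H G)
    (p : Gt × H) : C^∞⟮𝓘(ℝ, F), H; 𝓘(ℝ, E).prod 𝓘(ℝ, F), Gt × H⟯ :=
  ⟨fun x => (p.1, p.2 * x), contMDiff_const.prodMk (contMDiff_const.mul contMDiff_id)⟩

/- The fibre product of `p_{12}^* L` and `p_{23}^* L` over `Gt ×_G Gt ×_G Gt` is the manifold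
`Gt × H × H`, where `(g, h, h')` stands for the points `(g, h)` of `p_{12}^* L` and `(f(h) g, h')`
of `p_{23}^* L` over `(g, f(h) g, f(h') f(h) g)`. -/

/-- The projection to `p_{12}^* L`. -/
def pairFst (_X : CentralLieCrossedModule (E := E) (F := F) (B := B) Gt H G)
    : C^∞⟮𝓘(ℝ, E).prod (𝓘(ℝ, F).prod 𝓘(ℝ, F)), Gt × H × H;
    𝓘(ℝ, E).prod 𝓘(ℝ, F), Gt × H⟯ :=
  ⟨fun p => (p.1, p.2.1), contMDiff_fst.prodMk (contMDiff_fst.comp contMDiff_snd)⟩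

/-- The projection to `p_{23}^* L`. -/
def pairSnd : C^∞⟮𝓘(ℝ, E).prod (𝓘(ℝ, F).prod 𝓘(ℝ, F)), Gt × H × H;
    𝓘(ℝ, E).prod 𝓘(ℝ, F), Gt × H⟯ :=
  ⟨fun p => (X.f p.2.1 * p.1, p.2.2),
    ((X.smooth_f.comp (contMDiff_fst.comp contMDiff_snd)).mul contMDiff_fst).prodMk
      (contMDiff_snd.comp contMDiff_snd)⟩

/-- The gerbe product `p_{12}^* L ⊗ p_{23}^* L → p_{13}^* L`, `[h, h'] ↦ h' h`. -/
def gerbeProd (_X : CentralLieCrossedModule (E := E) (F := F) (B := B) Gt H G)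
    : C^∞⟮𝓘(ℝ, E).prod (𝓘(ℝ, F).prod 𝓘(ℝ, F)), Gt × H × H;
    𝓘(ℝ, E).prod 𝓘(ℝ, F), Gt × H⟯ :=
  ⟨fun p => (p.1, p.2.2 * p.2.1),
    contMDiff_fst.prodMk ((contMDiff_snd.comp contMDiff_snd).mul
      (contMDiff_fst.comp contMDiff_snd))⟩

/- The multiplication `m : g₁^* 𝒢 ⊗ g₂^* 𝒢 → (g₁ g₂)^* 𝒢` is an isomorphism of gerbes over
`G × G`, given over the surjective submersion `Gt × Gt → G × G`. -/

/-- The isomorphism of `T`-bundles `g₁^* L ⊗ g₂^* L → (g₁ g₂)^* L` over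
`(Gt × Gt) ×_{G × G} (Gt × Gt)` underlying `m`, that is, `[h₁, h₂] ↦ h₁ · (g₁ ▷ h₂)`. -/
def mulL : C^∞⟮(𝓘(ℝ, E).prod 𝓘(ℝ, F)).prod (𝓘(ℝ, E).prod 𝓘(ℝ, F)), (Gt × H) × (Gt × H);
    𝓘(ℝ, E).prod 𝓘(ℝ, F), Gt × H⟯ :=
  ⟨fun p => (p.1.1 * p.2.1, p.1.2 * X.act p.1.1 p.2.2),
    ((contMDiff_fst.comp contMDiff_fst).mul (contMDiff_fst.comp contMDiff_snd)).prodMk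
      ((contMDiff_snd.comp contMDiff_fst).mul
        (X.smooth_act.comp
          ((contMDiff_fst.comp contMDiff_fst).prodMk (contMDiff_snd.comp contMDiff_snd))))⟩

/-- The first component `L × L → Gt × Gt` of the projection of `L × L`. -/
def src₂ (_X : CentralLieCrossedModule (E := E) (F := F) (B := B) Gt H G)
    : C^∞⟮(𝓘(ℝ, E).prod 𝓘(ℝ, F)).prod (𝓘(ℝ, E).prod 𝓘(ℝ, F)), (Gt × H) × (Gt × H);
    𝓘(ℝ, E).prod 𝓘(ℝ, E), Gt × Gt⟯ :=
  ⟨fun p => (_X.src p.1, _X.src p.2),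
    (_X.src.contMDiff.comp contMDiff_fst).prodMk (_X.src.contMDiff.comp contMDiff_snd)⟩

/-- The second component `L × L → Gt × Gt` of the projection of `L × L`. -/
def tgt₂ : C^∞⟮(𝓘(ℝ, E).prod 𝓘(ℝ, F)).prod (𝓘(ℝ, E).prod 𝓘(ℝ, F)), (Gt × H) × (Gt × H);
    𝓘(ℝ, E).prod 𝓘(ℝ, E), Gt × Gt⟯ :=
  ⟨fun p => (X.tgt p.1, X.tgt p.2),
    (X.tgt.contMDiff.comp contMDiff_fst).prodMk (X.tgt.contMDiff.comp contMDiff_snd)⟩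

/-- The projection `L × L → L` to the first factor. -/
def fstL (_X : CentralLieCrossedModule (E := E) (F := F) (B := B) Gt H G)
    : C^∞⟮(𝓘(ℝ, E).prod 𝓘(ℝ, F)).prod (𝓘(ℝ, E).prod 𝓘(ℝ, F)), (Gt × H) × (Gt × H);
    𝓘(ℝ, E).prod 𝓘(ℝ, F), Gt × H⟯ := ⟨fun p => p.1, contMDiff_fst⟩

/-- The projection `L × L → L` to the second factor. -/
def sndL (_X : CentralLieCrossedModule (E := E) (F := F) (B := B) Gt H G)
    : C^∞⟮(𝓘(ℝ, E).prod 𝓘(ℝ, F)).prod (𝓘(ℝ, E).prod 𝓘(ℝ, F)), (Gt × H) × (Gt × H);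
    𝓘(ℝ, E).prod 𝓘(ℝ, F), Gt × H⟯ := ⟨fun p => p.2, contMDiff_snd⟩

/-- The map `g₁ : Gt × Gt → Gt`. -/
def face₁ (_X : CentralLieCrossedModule (E := E) (F := F) (B := B) Gt H G)
    : C^∞⟮𝓘(ℝ, E).prod 𝓘(ℝ, E), Gt × Gt; 𝓘(ℝ, E), Gt⟯ := ⟨fun p => p.1, contMDiff_fst⟩

/-- The map `g₂ : Gt × Gt → Gt`. -/
def face₂ (_X : CentralLieCrossedModule (E := E) (F := F) (B := B) Gt H G)
    : C^∞⟮𝓘(ℝ, E).prod 𝓘(ℝ, E), Gt × Gt; 𝓘(ℝ, E), Gt⟯ := ⟨fun p => p.2, contMDiff_snd⟩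

/-- The map `g₁ g₂ : Gt × Gt → Gt`. -/
def face₁₂ (_X : CentralLieCrossedModule (E := E) (F := F) (B := B) Gt H G)
    : C^∞⟮𝓘(ℝ, E).prod 𝓘(ℝ, E), Gt × Gt; 𝓘(ℝ, E), Gt⟯ :=
  ⟨fun p => p.1 * p.2, contMDiff_fst.mul contMDiff_snd⟩

/-- The map `(g₁, g₂) : Gt × Gt × Gt → Gt × Gt`. -/
def face_1_2 (_X : CentralLieCrossedModule (E := E) (F := F) (B := B) Gt H G)
    : C^∞⟮𝓘(ℝ, E).prod (𝓘(ℝ, E).prod 𝓘(ℝ, E)), Gt × Gt × Gt;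
    𝓘(ℝ, E).prod 𝓘(ℝ, E), Gt × Gt⟯ :=
  ⟨fun p => (p.1, p.2.1), contMDiff_fst.prodMk (contMDiff_fst.comp contMDiff_snd)⟩

/-- The map `(g₂, g₃) : Gt × Gt × Gt → Gt × Gt`. -/
def face_2_3 (_X : CentralLieCrossedModule (E := E) (F := F) (B := B) Gt H G)
    : C^∞⟮𝓘(ℝ, E).prod (𝓘(ℝ, E).prod 𝓘(ℝ, E)), Gt × Gt × Gt;
    𝓘(ℝ, E).prod 𝓘(ℝ, E), Gt × Gt⟯ :=
  ⟨fun p => (p.2.1, p.2.2),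
    (contMDiff_fst.comp contMDiff_snd).prodMk (contMDiff_snd.comp contMDiff_snd)⟩

/-- The map `(g₁ g₂, g₃) : Gt × Gt × Gt → Gt × Gt`. -/
def face_12_3 (_X : CentralLieCrossedModule (E := E) (F := F) (B := B) Gt H G)
    : C^∞⟮𝓘(ℝ, E).prod (𝓘(ℝ, E).prod 𝓘(ℝ, E)), Gt × Gt × Gt;
    𝓘(ℝ, E).prod 𝓘(ℝ, E), Gt × Gt⟯ :=
  ⟨fun p => (p.1 * p.2.1, p.2.2),
    (contMDiff_fst.mul (contMDiff_fst.comp contMDiff_snd)).prodMk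
      (contMDiff_snd.comp contMDiff_snd)⟩

/-- The map `(g₁, g₂ g₃) : Gt × Gt × Gt → Gt × Gt`. -/
def face_1_23 (_X : CentralLieCrossedModule (E := E) (F := F) (B := B) Gt H G)
    : C^∞⟮𝓘(ℝ, E).prod (𝓘(ℝ, E).prod 𝓘(ℝ, E)), Gt × Gt × Gt;
    𝓘(ℝ, E).prod 𝓘(ℝ, E), Gt × Gt⟯ :=
  ⟨fun p => (p.1, p.2.1 * p.2.2),
    contMDiff_fst.prodMk
      ((contMDiff_fst.comp contMDiff_snd).mul (contMDiff_snd.comp contMDiff_snd))⟩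

/-! The next facts say that the maps above form a multiplicative bundle gerbe over `G`. -/

/-- The image of `L` in `Gt × Gt` is the fibre product `Gt ×_G Gt`. -/
theorem π_eq_iff (g g' : Gt) : X.π g = X.π g' ↔ ∃ h : H, X.tgt (g, h) = g' := by
  have key : X.π g = X.π g' ↔ g' * g⁻¹ ∈ X.f.range := by
    rw [← X.ker_π, MonoidHom.mem_ker, map_mul, map_inv, mul_inv_eq_one, eq_comm]
  rw [key]
  constructor
  · rintro ⟨h, hh⟩
    exact ⟨h, by change X.f h * g = g'; rw [hh]; simp⟩
  · rintro ⟨h, hh⟩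
    exact ⟨h, by rw [← hh]; change X.f h = X.f h * g * g⁻¹; simp⟩

/-- `T` acts simply transitively on the fibres of `L`. -/
theorem tgt_eq_iff (g : Gt) (h h' : H) :
    X.tgt (g, h) = X.tgt (g, h') ↔ ∃! t, t ∈ X.f.ker ∧ X.translate t (g, h) = (g, h') := by
  change X.f h * g = X.f h' * g ↔ ∃! t, t ∈ X.f.ker ∧ ((g, h * t) : Gt × H) = (g, h')
  rw [mul_left_inj]
  constructor
  · intro e
    refine ⟨h⁻¹ * h', ⟨by simp [MonoidHom.mem_ker, e], by simp⟩, ?_⟩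
    rintro t ⟨-, ht⟩
    rw [← (Prod.mk.inj ht).2]; simp
  · rintro ⟨t, ⟨ht, e⟩, -⟩
    rw [← (Prod.mk.inj e).2, map_mul, MonoidHom.mem_ker.1 ht, mul_one]

/-- Elements of `T` are central in `H`. -/
theorem mul_ker_comm (h : H) {t : H} (ht : t ∈ X.f.ker) : h * t = t * h := by
  have e := X.act_ker (X.f h) t ht
  rw [X.act_f] at e
  exact mul_inv_eq_iff_eq_mul.1 e

/-- The gerbe product covers the projections to `Gt`. -/
theorem gerbeProd_covers (p : Gt × H × H) :
    X.tgt (X.pairFst p) = X.src (X.pairSnd p) ∧ X.src (X.gerbeProd p) = X.src (X.pairFst p) ∧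
      X.tgt (X.gerbeProd p) = X.tgt (X.pairSnd p) := by
  refine ⟨rfl, rfl, ?_⟩
  change X.f (p.2.2 * p.2.1) * p.1 = X.f p.2.2 * (X.f p.2.1 * p.1)
  rw [map_mul, mul_assoc]

/-- `mulL` covers the multiplication of `Gt`. -/
theorem mulL_covers (p : (Gt × H) × (Gt × H)) :
    X.src (X.mulL p) = X.face₁₂ (X.src₂ p) ∧ X.tgt (X.mulL p) = X.face₁₂ (X.tgt₂ p) := by
  refine ⟨rfl, ?_⟩
  change X.f (p.1.2 * X.act p.1.1 p.2.2) * (p.1.1 * p.2.1) =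
    X.f p.1.2 * p.1.1 * (X.f p.2.2 * p.2.1)
  rw [map_mul, X.f_act]
  group

/-- `mulL` is compatible with the actions of `T`. -/
theorem mulL_translate (p q : Gt × H) {t t' : H} (ht : t ∈ X.f.ker) (ht' : t' ∈ X.f.ker) :
    X.mulL (X.translate t p, X.translate t' q) = X.translate (t * t') (X.mulL (p, q)) := by
  change (p.1 * q.1, p.2 * t * X.act p.1 (q.2 * t')) =
    (p.1 * q.1, p.2 * X.act p.1 q.2 * (t * t'))
  rw [map_mul, X.act_ker _ _ ht', mul_assoc p.2 t, ← mul_assoc t, ← X.mul_ker_comm _ ht]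
  simp only [mul_assoc]

/-- `mulL` is compatible with the gerbe products. -/
theorem mulL_gerbeProd (p q : Gt × H × H) :
    X.mulL (X.gerbeProd p, X.gerbeProd q) =
      X.gerbeProd (p.1 * q.1, (X.mulL (X.pairFst p, X.pairFst q)).2,
        (X.mulL (X.pairSnd p, X.pairSnd q)).2) := by
  change (p.1 * q.1, p.2.2 * p.2.1 * X.act p.1 (q.2.2 * q.2.1)) =
    (p.1 * q.1, p.2.2 * X.act (X.f p.2.1 * p.1) q.2.2 * (p.2.1 * X.act p.1 q.2.1))
  rw [map_mul, map_mul, MulAut.mul_apply, X.act_f]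
  simp only [mul_assoc, inv_mul_cancel_left]

/-- The associator of `m` is the identity. -/
theorem mulL_assoc (p q r : Gt × H) :
    X.mulL (X.mulL (p, q), r) = X.mulL (p, X.mulL (q, r)) := by
  change (p.1 * q.1 * r.1, p.2 * X.act p.1 q.2 * X.act (p.1 * q.1) r.2) =
    (p.1 * (q.1 * r.1), p.2 * X.act p.1 (q.2 * X.act q.1 r.2))
  rw [map_mul, map_mul, MulAut.mul_apply]
  simp only [mul_assoc]

/-! ### Connective structures -/

/-- A connective structure on the multiplicative gerbe of `X`. -/
structure ConnectiveStructure where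
  /-- the connective structure on the gerbe: a connection on the principal `T`-bundle `L` -/
  conn : OneForm (𝓘(ℝ, E).prod 𝓘(ℝ, F)) (Gt × H) X.lieT
  conn_translate : ∀ t ∈ X.f.ker, OneForm.pullback (X.translate t) conn = conn
  /-- `conn` maps the fundamental vector field of `u ∈ Lie T` to `u` -/
  conn_fundamental : ∀ (p : Gt × H) (u : X.lieT),
    (OneForm.pullback (X.orbit p) conn).toFun 1 (u : F) = u
  /-- the gerbe product `p_{12}^* L ⊗ p_{23}^* L → p_{13}^* L` is flat -/
  conn_gerbeProd : OneForm.pullback X.gerbeProd conn =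
    OneForm.pullback X.pairFst conn + OneForm.pullback X.pairSnd conn
  /-- a connection on the isomorphism of gerbes `m : g₁^* 𝒢 ⊗ g₂^* 𝒢 → (g₁ g₂)^* 𝒢`: a 1-form
  whose difference over the two points of the fibre product measures the failure of the bundle
  isomorphism to be flat -/
  mConn : OneForm (𝓘(ℝ, E).prod 𝓘(ℝ, E)) (Gt × Gt) X.lieT
  mConn_isConnection : OneForm.pullback X.tgt₂ mConn - OneForm.pullback X.src₂ mConn =
    OneForm.pullback X.mulL conn - (OneForm.pullback X.fstL conn + OneForm.pullback X.sndL conn)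
  /-- the associator, which is the identity, is a flat 2-isomorphism -/
  assoc_flat : OneForm.pullback X.face_1_2 mConn + OneForm.pullback X.face_12_3 mConn =
    OneForm.pullback X.face_1_23 mConn + OneForm.pullback X.face_2_3 mConn

/-- An isomorphism of connective structures: a connection on the identity isomorphism of the
gerbe, given by a 1-form on `Gt`, such that the square formed with the two connections on `m`
commutes. -/
@[ext]
structure ConnectiveStructure.Iso (c₁ c₂ : X.ConnectiveStructure) where
  form : OneForm 𝓘(ℝ, E) Gt X.lieT
  isConnection :
    c₂.conn - c₁.conn = OneForm.pullback X.tgt form - OneForm.pullback X.src form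
  square : c₁.mConn + OneForm.pullback X.face₁₂ form =
    (OneForm.pullback X.face₁ form + OneForm.pullback X.face₂ form) + c₂.mConn

/-- The category of connective structures; composition adds the connections. -/
instance : Category X.ConnectiveStructure where
  Hom c₁ c₂ := ConnectiveStructure.Iso X c₁ c₂
  id c :=
    { form := 0
      isConnection := by simp
      square := by simp }
  comp {c₁ c₂ c₃} σ ρ :=
    { form := σ.form + ρ.form
      isConnection := by
        rw [← sub_add_sub_cancel c₃.conn c₂.conn c₁.conn, σ.isConnection, ρ.isConnection,
          OneForm.pullback_add, OneForm.pullback_add]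
        abel
      square := by
        rw [OneForm.pullback_add, OneForm.pullback_add, OneForm.pullback_add, ← add_assoc,
          σ.square, add_assoc, ρ.square]
        abel }
  id_comp σ := ConnectiveStructure.Iso.ext (zero_add σ.form)
  comp_id σ := ConnectiveStructure.Iso.ext (add_zero σ.form)
  assoc σ ρ μ := ConnectiveStructure.Iso.ext (add_assoc σ.form ρ.form μ.form)

/-! ### Strong adjustments -/

/-- A strong adjustment `(s, κ)` on `X`. -/
structure StrongAdjustment where
  s : F →L[ℝ] X.lieT
  s_splits : ∀ u : X.lieT, s (u : F) = u
  κ : Gt → E →L[ℝ] X.lieT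
  smooth_κ : ContMDiff 𝓘(ℝ, E) 𝓘(ℝ, E →L[ℝ] X.lieT) ∞ κ
  κ_mul : ∀ (g₁ g₂ : Gt) (v : E), κ (g₁ * g₂) v = κ g₂ (lieAd g₁⁻¹ v) + κ g₁ v
  κ_f : ∀ (h : H) (v : E), κ (X.f h) v = s (X.dactAt h v)
  κ_df : ∀ (g : Gt) (u : F), κ g (X.df u) = s (X.dact g⁻¹ u - u)

/-- An isomorphism of strong adjustments. -/
@[ext]
structure StrongAdjustment.Iso (a₁ a₂ : X.StrongAdjustment) where
  φ : E →L[ℝ] X.lieT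
  s_sub : ∀ u : F, a₂.s u - a₁.s u = φ (X.df u)
  κ_sub : ∀ (g : Gt) (v : E), a₂.κ g v - a₁.κ g v = φ (lieAd g⁻¹ v - v)

/-- The category of strong adjustments; composition adds the linear maps. -/
instance : Category X.StrongAdjustment where
  Hom a₁ a₂ := StrongAdjustment.Iso X a₁ a₂
  id a :=
    { φ := 0
      s_sub := by simp
      κ_sub := by simp }
  comp {a₁ a₂ a₃} φ ψ :=
    { φ := φ.φ + ψ.φ
      s_sub := fun u => by
        rw [← sub_add_sub_cancel (a₃.s u) (a₂.s u) (a₁.s u), φ.s_sub, ψ.s_sub, add_comm]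
        rfl
      κ_sub := fun g v => by
        rw [← sub_add_sub_cancel (a₃.κ g v) (a₂.κ g v) (a₁.κ g v), φ.κ_sub, ψ.κ_sub, add_comm]
        rfl }
  id_comp φ := StrongAdjustment.Iso.ext (zero_add φ.φ)
  comp_id φ := StrongAdjustment.Iso.ext (add_zero φ.φ)
  assoc φ ψ χ := StrongAdjustment.Iso.ext (add_assoc φ.φ ψ.φ χ.φ)

end CentralLieCrossedModule

end Main

end

/-!
The equivalence is induced by an explicit functor from strong adjustments to connective structures.
Write `θ = g⁻¹ dg` for the left Maurer-Cartan form. A strong adjustment `(s, κ)` is sent to the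
connections `s(g⁻¹ ▷ h⁻¹ dh)` on `L` and `κ(g₂, θ₁)` on the multiplication
(`StrongAdjustment.toConnectiveStructure`), and a morphism `φ` to the form `φ(θ)`.

In the left trivialization of the tangent bundles, a 1-form on a Lie group or on a product of two
Lie groups is a family of linear maps on Lie algebras (`OneForm.coeff`, `OneForm.coeffFst`,
`OneForm.coeffSnd`), and a pullback is computed from the logarithmic derivatives of the components
of the map (`OneForm.coord_pullback_eq_coeff₂`). By the product rule (`lieLogDeriv_mul`) and the
rule for the action (`CentralLieCrossedModule.lieLogDeriv_act`), every axiom on forms turns into a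
linear identity involving `Ad`, `f`, `▷` and `h⁻¹ (v ▷ h)` (the lemmas ending in `_iff`). The axioms of a
strong adjustment are what is needed for the identities of a connective structure to hold.

The functor is fully faithful because a morphism `σ` between two structures in its image satisfies
`σ(g₁g₂) - σ(g₂) = 0` on vectors tangent to the second factor, hence is left-invariant
(`StrongAdjustment.coeff_eq_coeff_one`), that is `σ = φ(θ)`.

It is essentially surjective because the flatness of the associator makes the connection `τ` on the
multiplication a cocycle, whose component along the second factor is the coboundary of the form
`σ(g) = τ(g, 1)(0, θ)` (`ConnectiveStructure.coeffSnd_mConn_eq_sub`). Twisting by `-σ` gives an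
isomorphic structure with `τ` vanishing on the second factor. Such a normalized structure comes from
a strong adjustment: `τ` is invariant under left translations in the first factor, so that
`τ = κ(g₂, θ₁)` for a cocycle `κ`, and the connection on `L` is determined by its restriction `s` to
`Lie H` at the identity (`ConnectiveStructure.IsNormalized.conn_eq`).
-/

noncomputable section

/-! ### Logarithmic derivatives of maps to a Lie group -/

section ModelDeriv

variable {EM : Type*} [NormedAddCommGroup EM] [NormedSpace ℝ EM]
  {HM : Type*} [TopologicalSpace HM] (I : ModelWithCorners ℝ EM HM)
  {M : Type*} [TopologicalSpace M] [ChartedSpace HM M]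
  {EN : Type*} [NormedAddCommGroup EN] [NormedSpace ℝ EN]
  {HN : Type*} [TopologicalSpace HN] (J : ModelWithCorners ℝ EN HN)
  {N : Type*} [TopologicalSpace N] [ChartedSpace HN N]
  {EP : Type*} [NormedAddCommGroup EP] [NormedSpace ℝ EP]
  {HP : Type*} [TopologicalSpace HP] (K : ModelWithCorners ℝ EP HP)
  {P : Type*} [TopologicalSpace P] [ChartedSpace HP P]

/-- The manifold derivative, viewed as a map of model vector spaces. Since each tangent space is a
type synonym of the model space, forgetting the base points makes it possible to rewrite them. -/
def modelDeriv (φ : N → M) (x : N) : EN →L[ℝ] EM := mfderiv J I φ x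

variable {I J K}

theorem modelDeriv_comp {ψ : M → P} {φ : N → M} {x : N} {y : M} (hy : φ x = y)
    (hψ : MDifferentiableAt I K ψ y) (hφ : MDifferentiableAt J I φ x) (v : EN) :
    modelDeriv K J (fun z => ψ (φ z)) x v = modelDeriv K I ψ y (modelDeriv I J φ x v) := by
  subst hy
  have h := mfderiv_comp x hψ hφ
  exact congrArg (fun L : EN →L[ℝ] EP => L v) h

theorem modelDeriv_prodMk {φ : N → M} {ψ : N → P} {x : N}
    (hφ : MDifferentiableAt J I φ x) (hψ : MDifferentiableAt J K ψ x) (v : EN) :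
    modelDeriv (I.prod K) J (fun z => (φ z, ψ z)) x v =
      (modelDeriv I J φ x v, modelDeriv K J ψ x v) := by
  have h := mfderiv_prodMk hφ hψ
  exact congrArg (fun L : EN →L[ℝ] EM × EP => L v) h

theorem modelDeriv_const (y : M) (x : N) : modelDeriv I J (fun _ : N => y) x = 0 :=
  mfderiv_const

theorem modelDeriv_id (x : M) (v : EM) : modelDeriv I I (fun z : M => z) x v = v := by
  have h := mfderiv_id (I := I) (x := x)
  exact congrArg (fun L : EM →L[ℝ] EM => L v) h

theorem modelDeriv_fst (p : M × N) (v : EM × EN) :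
    modelDeriv I (I.prod J) (Prod.fst : M × N → M) p v = v.1 := by
  have h := mfderiv_fst (I := I) (I' := J) (x := p)
  exact congrArg (fun L : EM × EN →L[ℝ] EM => L v) h

theorem modelDeriv_snd (p : M × N) (v : EM × EN) :
    modelDeriv J (I.prod J) (Prod.snd : M × N → N) p v = v.2 := by
  have h := mfderiv_snd (I := I) (I' := J) (x := p)
  exact congrArg (fun L : EM × EN →L[ℝ] EN => L v) h

theorem modelDeriv_inl (x : M) (y : N) (v : EM) :
    modelDeriv (I.prod J) I (fun z : M => (z, y)) x v = (v, 0) := by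
  have h := modelDeriv_prodMk (I := I) (J := I) (K := J) (φ := fun z : M => z)
    (ψ := fun _ : M => y) (x := x) mdifferentiableAt_id mdifferentiableAt_const v
  rw [modelDeriv_id, modelDeriv_const] at h
  exact h

theorem modelDeriv_inr (x : M) (y : N) (v : EN) :
    modelDeriv (I.prod J) J (fun z : N => (x, z)) y v = (0, v) := by
  have h := modelDeriv_prodMk (I := I) (J := J) (K := J) (φ := fun _ : N => x)
    (ψ := fun z : N => z) (x := y) mdifferentiableAt_const mdifferentiableAt_id v
  rw [modelDeriv_id, modelDeriv_const] at h
  exact h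

/-- The derivative of a function of two variables along a curve is the sum of the two partial
derivatives. -/
theorem modelDeriv_comp₂ {Q : Type*} [TopologicalSpace Q] {EQ : Type*} [NormedAddCommGroup EQ]
    [NormedSpace ℝ EQ] {HQ : Type*} [TopologicalSpace HQ] {IQ : ModelWithCorners ℝ EQ HQ}
    [ChartedSpace HQ Q]
    {μ : M × P → Q} {φ : N → M} {ψ : N → P} {x : N} {y : M} {z : P} (hy : φ x = y) (hz : ψ x = z)
    (hμ : MDifferentiableAt (I.prod K) IQ μ (y, z))
    (hφ : MDifferentiableAt J I φ x) (hψ : MDifferentiableAt J K ψ x) (v : EN) :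
    modelDeriv IQ J (fun t => μ (φ t, ψ t)) x v =
      modelDeriv IQ I (fun m => μ (m, z)) y (modelDeriv I J φ x v) +
        modelDeriv IQ K (fun p => μ (y, p)) z (modelDeriv K J ψ x v) := by
  rw [modelDeriv_comp (φ := fun t => (φ t, ψ t)) (y := (y, z)) (by rw [hy, hz]) hμ
    (hφ.prodMk hψ), modelDeriv_prodMk hφ hψ]
  have h := mfderiv_prod_eq_add_apply hμ (v := (modelDeriv I J φ x v, modelDeriv K J ψ x v))
  exact h

end ModelDeriv

section LogDeriv

variable {E : Type*} [NormedAddCommGroup E] [NormedSpace ℝ E]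
  {A : Type*} [TopologicalSpace A] [ChartedSpace E A] [Group A] [LieGroup 𝓘(ℝ, E) ∞ A]
  {EN : Type*} [NormedAddCommGroup EN] [NormedSpace ℝ EN]
  {HN : Type*} [TopologicalSpace HN] {J : ModelWithCorners ℝ EN HN}
  {N : Type*} [TopologicalSpace N] [ChartedSpace HN N]

theorem lieAd_eq (g : A) :
    lieAd g = modelDeriv 𝓘(ℝ, E) 𝓘(ℝ, E) (fun x : A => g * x * g⁻¹) 1 := rfl

variable (J) in
/-- The left logarithmic derivative of a map `a` to a Lie group: the derivative at `x` of
`y ↦ (a x)⁻¹ * a y`, with values in the Lie algebra. -/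
def lieLogDeriv (a : N → A) (x : N) : EN →L[ℝ] E :=
  modelDeriv 𝓘(ℝ, E) J (fun y => (a x)⁻¹ * a y) x

theorem mdifferentiable_lieMul_left (g : A) :
    MDifferentiable 𝓘(ℝ, E) 𝓘(ℝ, E) (fun x : A => g * x) :=
  (contMDiff_mul_left (n := ∞) (I := 𝓘(ℝ, E))).mdifferentiable (by simp)

theorem mdifferentiable_lieMul :
    MDifferentiable (𝓘(ℝ, E).prod 𝓘(ℝ, E)) 𝓘(ℝ, E) (fun p : A × A => p.1 * p.2) :=
  (contMDiff_mul 𝓘(ℝ, E) ∞).mdifferentiable (by simp)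

theorem mdifferentiable_conj (g : A) :
    MDifferentiable 𝓘(ℝ, E) 𝓘(ℝ, E) (fun x : A => g * x * g⁻¹) :=
  (((contMDiff_const.mul contMDiff_id).mul contMDiff_const :
    ContMDiff 𝓘(ℝ, E) 𝓘(ℝ, E) ∞ (fun x : A => g * x * g⁻¹))).mdifferentiable (by simp)

theorem MDifferentiableAt.const_mul_lie {a : N → A} {x : N} (g : A)
    (ha : MDifferentiableAt J 𝓘(ℝ, E) a x) :
    MDifferentiableAt J 𝓘(ℝ, E) (fun y => g * a y) x :=
  (mdifferentiable_lieMul_left g (a x)).comp x ha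

theorem MDifferentiableAt.mul_lie {a b : N → A} {x : N}
    (ha : MDifferentiableAt J 𝓘(ℝ, E) a x) (hb : MDifferentiableAt J 𝓘(ℝ, E) b x) :
    MDifferentiableAt J 𝓘(ℝ, E) (fun y => a y * b y) x :=
  (mdifferentiable_lieMul (a x, b x)).comp x (ha.prodMk hb)

/-- The derivative of the multiplication at the identity is the addition. -/
theorem modelDeriv_mul_of_eq_one {a b : N → A} {x : N} (hx : a x = 1) (hx' : b x = 1)
    (ha : MDifferentiableAt J 𝓘(ℝ, E) a x) (hb : MDifferentiableAt J 𝓘(ℝ, E) b x) (v : EN) :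
    modelDeriv 𝓘(ℝ, E) J (fun y => a y * b y) x v =
      modelDeriv 𝓘(ℝ, E) J a x v + modelDeriv 𝓘(ℝ, E) J b x v := by
  rw [modelDeriv_comp₂ (μ := fun p : A × A => p.1 * p.2) hx hx' (mdifferentiable_lieMul _) ha hb]
  simp only [mul_one, one_mul, modelDeriv_id]

theorem lieLogDeriv_const (a : A) (x : N) : lieLogDeriv (E := E) J (fun _ : N => a) x = 0 :=
  modelDeriv_const _ _

/-- The chain rule for logarithmic derivatives. -/
theorem lieLogDeriv_comp {EM : Type*} [NormedAddCommGroup EM] [NormedSpace ℝ EM]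
    {HM : Type*} [TopologicalSpace HM] {I : ModelWithCorners ℝ EM HM}
    {M : Type*} [TopologicalSpace M] [ChartedSpace HM M] {a : M → A} {φ : N → M} {x : N}
    (ha : MDifferentiableAt I 𝓘(ℝ, E) a (φ x)) (hφ : MDifferentiableAt J I φ x) (v : EN) :
    lieLogDeriv (E := E) J (fun y => a (φ y)) x v = lieLogDeriv I a (φ x) (modelDeriv I J φ x v) :=
  modelDeriv_comp (I := I) (K := 𝓘(ℝ, E)) (ψ := fun y => (a (φ x))⁻¹ * a y) rfl
    (ha.const_mul_lie (E := E) _) hφ v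

/-- The derivative of a map is recovered from its logarithmic derivative by a left translation. -/
theorem modelDeriv_mul_left_lieLogDeriv {a : N → A} {x : N}
    (ha : MDifferentiableAt J 𝓘(ℝ, E) a x) (v : EN) :
    modelDeriv 𝓘(ℝ, E) 𝓘(ℝ, E) (fun y : A => a x * y) 1 (lieLogDeriv J a x v) =
      modelDeriv 𝓘(ℝ, E) J a x v := by
  have h := modelDeriv_comp (φ := fun y => (a x)⁻¹ * a y) (ψ := fun y : A => a x * y) (x := x)
    (inv_mul_cancel (a x)) (mdifferentiable_lieMul_left (a x) 1) (ha.const_mul_lie _) v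
  simp only [mul_inv_cancel_left] at h
  exact h.symm

theorem lieLogDeriv_mul_left (g : A) (v : E) :
    lieLogDeriv 𝓘(ℝ, E) (fun x : A => g * x) 1 v = v := by
  simp only [lieLogDeriv, mul_one, inv_mul_cancel_left, modelDeriv_id]

/-- The product rule `θ(a b) = Ad(b⁻¹) θ(a) + θ(b)`. -/
theorem lieLogDeriv_mul {a b : N → A} {x : N}
    (ha : MDifferentiableAt J 𝓘(ℝ, E) a x) (hb : MDifferentiableAt J 𝓘(ℝ, E) b x) (v : EN) :
    lieLogDeriv (E := E) J (fun y => a y * b y) x v =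
      lieAd (b x)⁻¹ (lieLogDeriv J a x v) + lieLogDeriv J b x v := by
  have e : (fun y => (a x * b x)⁻¹ * (a y * b y)) = fun y =>
      ((b x)⁻¹ * ((a x)⁻¹ * a y) * (b x)⁻¹⁻¹) * ((b x)⁻¹ * b y) := by
    funext y; group
  have h : MDifferentiableAt J 𝓘(ℝ, E) (fun y => (b x)⁻¹ * ((a x)⁻¹ * a y) * (b x)⁻¹⁻¹) x :=
    (mdifferentiable_conj (E := E) (b x)⁻¹ ((a x)⁻¹ * a x)).comp x (ha.const_mul_lie (a x)⁻¹)
  rw [lieLogDeriv, e, modelDeriv_mul_of_eq_one (by simp) (by simp) h (hb.const_mul_lie (E := E) _),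
    modelDeriv_comp (ψ := fun y : A => (b x)⁻¹ * y * (b x)⁻¹⁻¹) (y := 1) (by simp)
      (mdifferentiable_conj (E := E) _ 1) (ha.const_mul_lie (E := E) _)]
  rfl

end LogDeriv

/-! ### 1-forms on Lie groups in the left trivialization -/

namespace OneForm

section General

variable {EM : Type*} [NormedAddCommGroup EM] [NormedSpace ℝ EM]
  {HM : Type*} [TopologicalSpace HM] {I : ModelWithCorners ℝ EM HM}
  {M : Type*} [TopologicalSpace M] [ChartedSpace HM M] [IsManifold I ∞ M]
  {EN : Type*} [NormedAddCommGroup EN] [NormedSpace ℝ EN]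
  {HN : Type*} [TopologicalSpace HN] {J : ModelWithCorners ℝ EN HN}
  {N : Type*} [TopologicalSpace N] [ChartedSpace HN N] [IsManifold J ∞ N]
  {V : Type*} [NormedAddCommGroup V] [NormedSpace ℝ V]
  {W : Type*} [NormedAddCommGroup W] [NormedSpace ℝ W]

/-- The value of a 1-form at a point, viewed as a map on the model vector space. -/
def coord (α : OneForm I M V) (x : M) : EM →L[ℝ] V := α.toFun x

theorem ext_coord {α β : OneForm I M V} (h : ∀ x v, α.coord x v = β.coord x v) : α = β :=
  OneForm.ext fun x => ContinuousLinearMap.ext (h x)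

theorem coord_add (α β : OneForm I M V) (x : M) (v : EM) :
    (α + β).coord x v = α.coord x v + β.coord x v := rfl

theorem coord_neg (α : OneForm I M V) (x : M) (v : EM) :
    (-α).coord x v = -α.coord x v := rfl

theorem coord_sub (α β : OneForm I M V) (x : M) (v : EM) :
    (α - β).coord x v = α.coord x v - β.coord x v := by
  rw [sub_eq_add_neg, coord_add, coord_neg, sub_eq_add_neg]

theorem coord_pullback (φ : C^∞⟮J, N; I, M⟯) (α : OneForm I M V) (x : N) (v : EN) :
    (pullback φ α).coord x v = α.coord (φ x) (modelDeriv I J φ x v) := rfl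

theorem pullback_neg (φ : C^∞⟮J, N; I, M⟯) (α : OneForm I M V) :
    pullback φ (-α) = -pullback φ α :=
  eq_neg_of_add_eq_zero_left (by rw [← pullback_add, neg_add_cancel, pullback_zero])

theorem pullback_sub (φ : C^∞⟮J, N; I, M⟯) (α β : OneForm I M V) :
    pullback φ (α - β) = pullback φ α - pullback φ β := by
  rw [sub_eq_add_neg, pullback_add, pullback_neg, sub_eq_add_neg]

theorem pullback_pullback {EP : Type*} [NormedAddCommGroup EP] [NormedSpace ℝ EP]
    {HP : Type*} [TopologicalSpace HP] {K : ModelWithCorners ℝ EP HP}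
    {P : Type*} [TopologicalSpace P] [ChartedSpace HP P] [IsManifold K ∞ P]
    (φ : C^∞⟮J, N; I, M⟯) (ψ : C^∞⟮K, P; J, N⟯) (α : OneForm I M V) :
    pullback ψ (pullback φ α) = pullback (φ.comp ψ) α :=
  ext_coord fun x v => by
    rw [coord_pullback, coord_pullback, coord_pullback]
    exact congrArg (α.coord (φ (ψ x))) (modelDeriv_comp rfl
      (φ.contMDiff.mdifferentiable (by simp) _) (ψ.contMDiff.mdifferentiable (by simp) _) v).symm

/-- The 1-form obtained from `α` by applying to its values a family of linear maps. -/
def clmComp (k : M → V →L[ℝ] W) (hk : ContMDiff I 𝓘(ℝ, V →L[ℝ] W) ∞ k) (α : OneForm I M V) :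
    OneForm I M W where
  toFun x := (k x).comp (α.toFun x)
  smooth := (hk.comp (Bundle.contMDiff_proj (TangentSpace I))).clm_apply α.smooth

theorem coord_clmComp (k : M → V →L[ℝ] W) (hk : ContMDiff I 𝓘(ℝ, V →L[ℝ] W) ∞ k)
    (α : OneForm I M V) (x : M) (v : EM) : (α.clmComp k hk).coord x v = k x (α.coord x v) := rfl

/-- A 1-form on a product, evaluated on a fixed tangent vector to the first factor, depends
smoothly on the point of the second factor. -/
theorem contMDiff_coord_inl (α : OneForm (I.prod J) (M × N) V) (x : M) (v : EM) :
    ContMDiff J 𝓘(ℝ, V) ∞ (fun y : N => α.coord (x, y) (v, 0)) := by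
  have h₀ : IsManifold I 1 M := .of_le (n := ∞) (by simp)
  have h₁ : IsManifold J 1 N := .of_le (n := ∞) (by simp)
  have hz : ContMDiff J J.tangent ∞ (fun y : N => (⟨y, 0⟩ : TangentBundle J N)) :=
    Bundle.contMDiff_zeroSection ℝ (TangentSpace J)
  have hc : ContMDiff J I.tangent ∞ (fun _ : N => (⟨x, v⟩ : TangentBundle I M)) :=
    contMDiff_const
  exact α.smooth.comp ((contMDiff_equivTangentBundleProd_symm (n := ∞)).comp (hc.prodMk hz))

end General

/-- On a finite-dimensional space, a family of linear maps is smooth if its values are. -/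
theorem _root_.contMDiff_clm_of_apply {EM : Type*} [NormedAddCommGroup EM] [NormedSpace ℝ EM]
    {HM : Type*} [TopologicalSpace HM] {I : ModelWithCorners ℝ EM HM}
    {M : Type*} [TopologicalSpace M] [ChartedSpace HM M]
    {V : Type*} [NormedAddCommGroup V] [NormedSpace ℝ V] [FiniteDimensional ℝ V]
    {W : Type*} [NormedAddCommGroup W] [NormedSpace ℝ W] {k : M → V →L[ℝ] W}
    (hk : ∀ v, ContMDiff I 𝓘(ℝ, W) ∞ (fun x => k x v)) :
    ContMDiff I 𝓘(ℝ, V →L[ℝ] W) ∞ k := by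
  have hd : Module.finrank ℝ V = Module.finrank ℝ (Fin (Module.finrank ℝ V) → ℝ) :=
    (Module.finrank_fin_fun ℝ).symm
  let e₁ := ContinuousLinearEquiv.ofFinrankEq hd
  let e₂ := (e₁.arrowCongr (1 : W ≃L[ℝ] W)).trans
    (ContinuousLinearEquiv.piRing (Fin (Module.finrank ℝ V)))
  have h : ContMDiff I 𝓘(ℝ, Fin (Module.finrank ℝ V) → W) ∞ (fun x => e₂ (k x)) :=
    contMDiff_pi_space.2 fun i => hk _
  have h' := e₂.symm.contDiff (n := ∞) |>.contMDiff.comp h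
  simpa [Function.comp_def] using h'

section LieGroup

variable {E : Type*} [NormedAddCommGroup E] [NormedSpace ℝ E]
  {A : Type*} [TopologicalSpace A] [ChartedSpace E A] [Group A] [LieGroup 𝓘(ℝ, E) ∞ A]
  {EN : Type*} [NormedAddCommGroup EN] [NormedSpace ℝ EN]
  {HN : Type*} [TopologicalSpace HN] {J : ModelWithCorners ℝ EN HN}
  {N : Type*} [TopologicalSpace N] [ChartedSpace HN N] [IsManifold J ∞ N]
  {V : Type*} [NormedAddCommGroup V] [NormedSpace ℝ V]
  {E' : Type*} [NormedAddCommGroup E'] [NormedSpace ℝ E']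
  {A' : Type*} [TopologicalSpace A'] [ChartedSpace E' A'] [Group A'] [LieGroup 𝓘(ℝ, E') ∞ A']

/-- A smooth map into the fibre over the identity of the tangent bundle of a Lie group is smooth as
a map into the Lie algebra. -/
theorem contMDiff_of_tangentBundle_one {ξ : N → TangentBundle 𝓘(ℝ, E) A}
    (hξ : ContMDiff J 𝓘(ℝ, E).tangent ∞ ξ) (h : ∀ x, (ξ x).1 = 1) :
    ContMDiff J 𝓘(ℝ, E) ∞ (fun x => ((ξ x).2 : E)) := by
  intro x₀
  have h₁ := (Bundle.contMDiffAt_totalSpace.1 (hξ x₀)).2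
  rw [h x₀] at h₁
  refine h₁.congr_of_eventuallyEq (Filter.Eventually.of_forall fun x => ?_)
  have key (p : TangentBundle 𝓘(ℝ, E) A) (hp : p.1 = 1) :
      (p.2 : E) = (trivializationAt E (TangentSpace 𝓘(ℝ, E)) (1 : A) p).2 := by
    obtain ⟨g, v⟩ := p
    obtain rfl : g = 1 := hp
    exact (congrArg Prod.snd
      ((tangentBundleCore 𝓘(ℝ, E) A).localTrivAt_apply_mk (1 : A) v)).symm
  exact key (ξ x) (h x)

/-- The value `T_g A → Lie A` at `g` of the left-invariant Maurer-Cartan form. -/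
def theta (g : A) : E →L[ℝ] E := lieLogDeriv 𝓘(ℝ, E) (fun x : A => x) g

variable (E A) in
/-- The left-invariant Maurer-Cartan form of a Lie group. -/
def maurerCartan : OneForm 𝓘(ℝ, E) A E where
  toFun g := theta (E := E) g
  smooth := by
    have h₀ : IsManifold 𝓘(ℝ, E) 1 A := .of_le (n := ∞) (by simp)
    have hμ : ContMDiff (𝓘(ℝ, E).prod 𝓘(ℝ, E)) 𝓘(ℝ, E) ∞ (fun p : A × A => p.1⁻¹ * p.2) :=
      contMDiff_fst.inv.mul contMDiff_snd
    have hz : ContMDiff 𝓘(ℝ, E).tangent 𝓘(ℝ, E).tangent ∞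
        (fun v : TangentBundle 𝓘(ℝ, E) A => (⟨v.1, 0⟩ : TangentBundle 𝓘(ℝ, E) A)) :=
      (Bundle.contMDiff_zeroSection ℝ (TangentSpace 𝓘(ℝ, E))).comp
        (Bundle.contMDiff_proj (TangentSpace 𝓘(ℝ, E)))
    -- The form is the restriction of the tangent map of `(x, y) ↦ x⁻¹ * y` to the vectors `(0, v)`
    -- over the diagonal.
    have h := (hμ.contMDiff_tangentMap (m := ∞) (by simp)).comp
      ((contMDiff_equivTangentBundleProd_symm (n := ∞)).comp (hz.prodMk contMDiff_id))
    have e (g : A) (w : E) : theta g w =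
        modelDeriv 𝓘(ℝ, E) (𝓘(ℝ, E).prod 𝓘(ℝ, E)) (fun p : A × A => p.1⁻¹ * p.2) (g, g) (0, w) := by
      rw [← modelDeriv_inr (I := 𝓘(ℝ, E)) (J := 𝓘(ℝ, E)) g g w]
      exact modelDeriv_comp (φ := fun x : A => (g, x)) rfl
        (hμ.mdifferentiable (by simp) _) (mdifferentiableAt_const.prodMk mdifferentiableAt_id) w
    exact (contMDiff_of_tangentBundle_one h fun v => inv_mul_cancel v.1).congr fun v => e v.1 v.2

theorem coord_maurerCartan (g : A) (v : E) :
    (maurerCartan E A).coord g v = theta g v := rfl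

theorem pullback_maurerCartan (φ : C^∞⟮J, N; 𝓘(ℝ, E), A⟯) (x : N) (v : EN) :
    (pullback φ (maurerCartan E A)).coord x v = lieLogDeriv J φ x v := by
  rw [coord_pullback, coord_maurerCartan]
  exact (lieLogDeriv_comp (a := fun x : A => x) (mdifferentiableAt_id)
    (φ.contMDiff.mdifferentiable (by simp) _) v).symm

/-- The left translation `Lie A → T_g A`. -/
def leftTranslation (g : A) : E →L[ℝ] E :=
  modelDeriv 𝓘(ℝ, E) 𝓘(ℝ, E) (fun x : A => g * x) 1

theorem theta_leftTranslation (g : A) (v : E) : theta g (leftTranslation g v) = v := by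
  have h := lieLogDeriv_comp (I := 𝓘(ℝ, E)) (J := 𝓘(ℝ, E)) (a := fun x : A => x)
    (φ := fun x : A => g * x) (x := 1) mdifferentiableAt_id (mdifferentiable_lieMul_left g 1) v
  rw [lieLogDeriv_mul_left, mul_one] at h
  exact h.symm

/-- The coefficient of a 1-form on a Lie group in the left trivialization of the tangent bundle. -/
def coeff (α : OneForm 𝓘(ℝ, E) A V) (g : A) : E →L[ℝ] V :=
  (α.coord g).comp (leftTranslation g)

/-- The first coefficient of a 1-form on a product of two Lie groups in the left trivialization of
the tangent bundle. -/
def coeffFst (α : OneForm (𝓘(ℝ, E).prod 𝓘(ℝ, E')) (A × A') V) (p : A × A') : E →L[ℝ] V :=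
  (α.coord p).comp ((ContinuousLinearMap.inl ℝ E E').comp (leftTranslation p.1))

/-- The second coefficient of a 1-form on a product of two Lie groups in the left trivialization of
the tangent bundle. -/
def coeffSnd (α : OneForm (𝓘(ℝ, E).prod 𝓘(ℝ, E')) (A × A') V) (p : A × A') : E' →L[ℝ] V :=
  (α.coord p).comp ((ContinuousLinearMap.inr ℝ E E').comp (leftTranslation p.2))

/-- A pullback to `N` is computed by the coefficients and the logarithmic derivatives. -/
theorem coord_pullback_eq_coeff (α : OneForm 𝓘(ℝ, E) A V) (φ : C^∞⟮J, N; 𝓘(ℝ, E), A⟯) (x : N)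
    (v : EN) : (pullback φ α).coord x v = α.coeff (φ x) (lieLogDeriv J φ x v) := by
  rw [coord_pullback, coeff, ContinuousLinearMap.comp_apply, leftTranslation,
    modelDeriv_mul_left_lieLogDeriv (φ.contMDiff.mdifferentiable (by simp) _)]

/-- The analogue of `coord_pullback_eq_coeff` for a product of two Lie groups. -/
theorem coord_pullback_eq_coeff₂ (α : OneForm (𝓘(ℝ, E).prod 𝓘(ℝ, E')) (A × A') V)
    (φ : C^∞⟮J, N; 𝓘(ℝ, E).prod 𝓘(ℝ, E'), A × A'⟯) (x : N) (v : EN) :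
    (pullback φ α).coord x v = α.coeffFst (φ x) (lieLogDeriv J (fun y => (φ y).1) x v) +
      α.coeffSnd (φ x) (lieLogDeriv J (fun y => (φ y).2) x v) := by
  have h₁ : MDifferentiableAt J 𝓘(ℝ, E) (fun y => (φ y).1) x :=
    (contMDiff_fst.comp φ.contMDiff).mdifferentiable (by simp) _
  have h₂ : MDifferentiableAt J 𝓘(ℝ, E') (fun y => (φ y).2) x :=
    (contMDiff_snd.comp φ.contMDiff).mdifferentiable (by simp) _
  have e := modelDeriv_prodMk h₁ h₂ v
  rw [coord_pullback, coeffFst, coeffSnd]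
  simp only [ContinuousLinearMap.comp_apply, leftTranslation]
  rw [modelDeriv_mul_left_lieLogDeriv h₁, modelDeriv_mul_left_lieLogDeriv h₂, ← map_add]
  refine congrArg _ (Eq.trans e ?_)
  simp

theorem coeffFst_apply (α : OneForm (𝓘(ℝ, E).prod 𝓘(ℝ, E')) (A × A') V) (p : A × A') (v : E) :
    α.coeffFst p v = α.coord p (leftTranslation p.1 v, 0) := rfl

theorem coeffSnd_apply (α : OneForm (𝓘(ℝ, E).prod 𝓘(ℝ, E')) (A × A') V) (p : A × A') (v : E') :
    α.coeffSnd p v = α.coord p (0, leftTranslation p.2 v) := rfl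

theorem leftTranslation_theta (g : A) (v : E) : leftTranslation g (theta g v) = v := by
  rw [leftTranslation, theta,
    modelDeriv_mul_left_lieLogDeriv (a := fun x : A => x) mdifferentiableAt_id, modelDeriv_id]

theorem coord_eq_coeff (α : OneForm 𝓘(ℝ, E) A V) (g : A) (v : E) :
    α.coord g v = α.coeff g (theta g v) := by
  rw [coeff, ContinuousLinearMap.comp_apply, leftTranslation_theta]

theorem coord_eq_coeff₂ (α : OneForm (𝓘(ℝ, E).prod 𝓘(ℝ, E')) (A × A') V) (p : A × A')
    (w : E × E') :
    α.coord p w = α.coeffFst p (theta p.1 w.1) + α.coeffSnd p (theta p.2 w.2) := by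
  rw [coeffFst_apply, coeffSnd_apply, leftTranslation_theta, leftTranslation_theta, ← map_add,
    Prod.mk_add_mk, add_zero, zero_add]

theorem coeff_clmComp_maurerCartan {k : A → E →L[ℝ] V}
    (hk : ContMDiff 𝓘(ℝ, E) 𝓘(ℝ, E →L[ℝ] V) ∞ k) (g : A) :
    ((maurerCartan E A).clmComp k hk).coeff g = k g := by
  ext v
  simp only [coeff, ContinuousLinearMap.comp_apply, coord_clmComp, coord_maurerCartan,
    theta_leftTranslation]

theorem ext_coeff {α β : OneForm 𝓘(ℝ, E) A V} (h : ∀ g, α.coeff g = β.coeff g) : α = β :=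
  ext_coord fun g v => by rw [coord_eq_coeff, coord_eq_coeff, h]

theorem ext_coeff₂ {α β : OneForm (𝓘(ℝ, E).prod 𝓘(ℝ, E')) (A × A') V}
    (h₁ : ∀ p, α.coeffFst p = β.coeffFst p) (h₂ : ∀ p, α.coeffSnd p = β.coeffSnd p) : α = β :=
  ext_coord fun p v => by rw [coord_eq_coeff₂, coord_eq_coeff₂, h₁, h₂]

theorem contMDiff_coeffFst [FiniteDimensional ℝ E]
    (α : OneForm (𝓘(ℝ, E).prod 𝓘(ℝ, E')) (A × A') V) :
    ContMDiff (𝓘(ℝ, E).prod 𝓘(ℝ, E')) 𝓘(ℝ, E →L[ℝ] V) ∞ α.coeffFst := by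
  refine contMDiff_clm_of_apply fun v => ?_
  let φ : C^∞⟮𝓘(ℝ, E).prod (𝓘(ℝ, E).prod 𝓘(ℝ, E')), A × (A × A');
      𝓘(ℝ, E).prod 𝓘(ℝ, E'), A × A'⟯ :=
    ⟨fun q => (q.2.1 * q.1, q.2.2), ((contMDiff_fst.comp contMDiff_snd).mul contMDiff_fst).prodMk
      (contMDiff_snd.comp contMDiff_snd)⟩
  -- The coefficient is the value of `φ^* α` on the tangent vector `v` at the identity of the
  -- auxiliary factor.
  refine (contMDiff_coord_inl (pullback φ α) (1 : A) v).congr fun p => ?_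
  have h := modelDeriv_comp (K := 𝓘(ℝ, E).prod 𝓘(ℝ, E')) (ψ := φ) (φ := fun x : A => (x, p))
    (x := 1) rfl (φ.contMDiff.mdifferentiable (by simp) _)
    (mdifferentiableAt_id.prodMk mdifferentiableAt_const) v
  rw [modelDeriv_inl] at h
  have h' := modelDeriv_prodMk (φ := fun x : A => p.1 * x) (ψ := fun _ : A => p.2) (x := 1)
    (mdifferentiable_lieMul_left (E := E) p.1 1) (mdifferentiableAt_const (I' := 𝓘(ℝ, E'))) v
  rw [modelDeriv_const] at h'
  rw [coord_pullback, ← h]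
  have e : φ (1, p) = p := by simp [φ]
  rw [e]
  exact congrArg (α.coord p) h'.symm

theorem contMDiff_coeffSnd [FiniteDimensional ℝ E']
    (α : OneForm (𝓘(ℝ, E).prod 𝓘(ℝ, E')) (A × A') V) :
    ContMDiff (𝓘(ℝ, E).prod 𝓘(ℝ, E')) 𝓘(ℝ, E' →L[ℝ] V) ∞ α.coeffSnd := by
  refine contMDiff_clm_of_apply fun v => ?_
  let φ : C^∞⟮𝓘(ℝ, E').prod (𝓘(ℝ, E).prod 𝓘(ℝ, E')), A' × (A × A');
      𝓘(ℝ, E).prod 𝓘(ℝ, E'), A × A'⟯ :=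
    ⟨fun q => (q.2.1, q.2.2 * q.1), (contMDiff_fst.comp contMDiff_snd).prodMk
      ((contMDiff_snd.comp contMDiff_snd).mul contMDiff_fst)⟩
  refine (contMDiff_coord_inl (pullback φ α) (1 : A') v).congr fun p => ?_
  have h := modelDeriv_comp (K := 𝓘(ℝ, E).prod 𝓘(ℝ, E')) (ψ := φ) (φ := fun x : A' => (x, p))
    (x := 1) rfl (φ.contMDiff.mdifferentiable (by simp) _)
    (mdifferentiableAt_id.prodMk mdifferentiableAt_const) v
  rw [modelDeriv_inl] at h
  have h' := modelDeriv_prodMk (φ := fun _ : A' => p.1) (ψ := fun x : A' => p.2 * x) (x := 1)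
    (mdifferentiableAt_const (I' := 𝓘(ℝ, E))) (mdifferentiable_lieMul_left (E := E') p.2 1) v
  rw [modelDeriv_const] at h'
  rw [coord_pullback, ← h]
  have e : φ (1, p) = p := by simp [φ]
  rw [e]
  exact congrArg (α.coord p) h'.symm

end LieGroup

end OneForm

/-! ### The differential calculus of a central Lie crossed module -/

section LieAd

variable {E : Type*} [NormedAddCommGroup E] [NormedSpace ℝ E]
  {A : Type*} [TopologicalSpace A] [ChartedSpace E A] [Group A] [LieGroup 𝓘(ℝ, E) ∞ A]

theorem lieAd_one (v : E) : lieAd (1 : A) v = v := by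
  rw [lieAd_eq]
  simp only [one_mul, inv_one, mul_one, modelDeriv_id]

end LieAd

namespace CentralLieCrossedModule

variable {E : Type*} [NormedAddCommGroup E] [NormedSpace ℝ E]
  {F : Type*} [NormedAddCommGroup F] [NormedSpace ℝ F]
  {B : Type*} [NormedAddCommGroup B] [NormedSpace ℝ B]
  {Gt : Type*} [TopologicalSpace Gt] [ChartedSpace E Gt] [Group Gt] [LieGroup 𝓘(ℝ, E) ∞ Gt]
  {H : Type*} [TopologicalSpace H] [ChartedSpace F H] [Group H] [LieGroup 𝓘(ℝ, F) ∞ H]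
  {G : Type*} [TopologicalSpace G] [ChartedSpace B G] [Group G]
  {EN : Type*} [NormedAddCommGroup EN] [NormedSpace ℝ EN]
  {HN : Type*} [TopologicalSpace HN] {J : ModelWithCorners ℝ EN HN}
  {N : Type*} [TopologicalSpace N] [ChartedSpace HN N]
  (X : CentralLieCrossedModule (E := E) (F := F) (B := B) Gt H G)

theorem mdifferentiable_f : MDifferentiable 𝓘(ℝ, F) 𝓘(ℝ, E) X.f :=
  X.smooth_f.mdifferentiable (by simp)

theorem mdifferentiable_act₂ :
    MDifferentiable (𝓘(ℝ, E).prod 𝓘(ℝ, F)) 𝓘(ℝ, F) (fun p : Gt × H => X.act p.1 p.2) :=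
  X.smooth_act.mdifferentiable (by simp)

theorem mdifferentiable_act (g : Gt) : MDifferentiable 𝓘(ℝ, F) 𝓘(ℝ, F) (X.act g) :=
  (X.smooth_act.comp (contMDiff_const.prodMk contMDiff_id)).mdifferentiable (by simp)

theorem mdifferentiable_act_left (h : H) :
    MDifferentiable 𝓘(ℝ, E) 𝓘(ℝ, F) (fun g : Gt => X.act g h) :=
  (X.smooth_act.comp (contMDiff_id.prodMk contMDiff_const)).mdifferentiable (by simp)

theorem df_eq : X.df = modelDeriv 𝓘(ℝ, E) 𝓘(ℝ, F) X.f 1 := rfl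

theorem dact_eq (g : Gt) : X.dact g = modelDeriv 𝓘(ℝ, F) 𝓘(ℝ, F) (fun h => X.act g h) 1 := rfl

theorem dactAt_eq (h : H) :
    X.dactAt h = modelDeriv 𝓘(ℝ, F) 𝓘(ℝ, E) (fun x : Gt => h⁻¹ * X.act x h) 1 := rfl

theorem dact_one (u : F) : X.dact 1 u = u := by
  rw [dact_eq]
  simp only [map_one, MulAut.one_apply, modelDeriv_id]

theorem dact_mul (g g' : Gt) (u : F) : X.dact (g * g') u = X.dact g (X.dact g' u) := by
  rw [dact_eq, dact_eq, dact_eq,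
    ← modelDeriv_comp (I := 𝓘(ℝ, F)) (φ := fun h => X.act g' h) (y := (1 : H)) (by simp)
      (X.mdifferentiable_act g 1) (X.mdifferentiable_act g' 1)]
  simp only [map_mul, MulAut.mul_apply]

/-- The Peiffer identity: the adjoint action of `H` is the restriction of the action of `Gt`. -/
theorem lieAd_eq_dact (h : H) : lieAd (E := F) h = X.dact (X.f h) := by
  rw [lieAd_eq, dact_eq]
  simp only [X.act_f]

theorem lieAd_df (g : Gt) (u : F) : lieAd g (X.df u) = X.df (X.dact g u) := by
  rw [lieAd_eq, df_eq, dact_eq,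
    ← modelDeriv_comp (I := 𝓘(ℝ, E)) (φ := fun h => X.f h) (x := 1) (y := (1 : Gt)) (by simp)
      (mdifferentiable_conj g 1) (X.mdifferentiable_f 1),
    ← modelDeriv_comp (I := 𝓘(ℝ, F)) (φ := fun h => X.act g h) (x := 1) (y := (1 : H)) (by simp)
      (X.mdifferentiable_f 1) (X.mdifferentiable_act g 1)]
  simp only [X.f_act]

/-- The infinitesimal form of `f(h⁻¹ (x ▷ h)) x = f(h)⁻¹ x f(h)`. -/
theorem df_dactAt (h : H) (v : E) : X.df (X.dactAt h v) = lieAd (X.f h)⁻¹ v - v := by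
  have hp : MDifferentiableAt 𝓘(ℝ, E) 𝓘(ℝ, F) (fun x : Gt => h⁻¹ * X.act x h) 1 :=
    (X.mdifferentiable_act_left h 1).const_mul_lie h⁻¹
  have e : (fun x : Gt => X.f (h⁻¹ * X.act x h) * x) =
      fun x => (X.f h)⁻¹ * x * (X.f h)⁻¹⁻¹ := by
    funext x
    rw [map_mul, X.f_act, map_inv]
    group
  have h₁ := modelDeriv_mul_of_eq_one (E := E) (J := 𝓘(ℝ, E)) (x := (1 : Gt))
    (a := fun x : Gt => X.f (h⁻¹ * X.act x h)) (b := fun x => x) (by simp) rfl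
    ((X.mdifferentiable_f _).comp 1 hp) mdifferentiableAt_id v
  rw [e, modelDeriv_id, modelDeriv_comp (I := 𝓘(ℝ, F)) (φ := fun x : Gt => h⁻¹ * X.act x h)
    (y := 1) (by simp) (X.mdifferentiable_f 1) hp] at h₁
  rw [lieAd_eq, h₁, df_eq, dactAt_eq, add_sub_cancel_right]

theorem lieLogDeriv_f {a : N → H} {x : N} (ha : MDifferentiableAt J 𝓘(ℝ, F) a x) (v : EN) :
    lieLogDeriv (E := E) J (fun y => X.f (a y)) x v = X.df (lieLogDeriv J a x v) := by
  rw [lieLogDeriv, lieLogDeriv, df_eq,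
    ← modelDeriv_comp (I := 𝓘(ℝ, F)) (φ := fun y => (a x)⁻¹ * a y) (y := (1 : H)) (by simp)
      (X.mdifferentiable_f 1) (ha.const_mul_lie _)]
  simp only [map_mul, map_inv]

/-- The logarithmic derivative of `g ▷ h`. -/
theorem lieLogDeriv_act {a : N → Gt} {b : N → H} {x : N}
    (ha : MDifferentiableAt J 𝓘(ℝ, E) a x) (hb : MDifferentiableAt J 𝓘(ℝ, F) b x) (v : EN) :
    lieLogDeriv (E := F) J (fun y => X.act (a y) (b y)) x v =
      X.dact (a x) (lieLogDeriv J b x v + X.dactAt (b x) (lieLogDeriv J a x v)) := by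
  -- After a translation, the dependence on `a` and on `b` is split into two factors through `1`.
  have e : (fun y => (X.act (a x) (b x))⁻¹ * X.act (a y) (b y)) = fun y =>
      X.act (a x) (((b x)⁻¹ * X.act ((a x)⁻¹ * a y) (b x)) *
        X.act ((a x)⁻¹ * a y) ((b x)⁻¹ * b y)) := by
    funext y
    simp only [map_mul, map_inv, MulAut.mul_apply, mul_assoc, mul_inv_cancel_left,
      MulAut.apply_inv_self]
  have ha' : MDifferentiableAt J 𝓘(ℝ, E) (fun y => (a x)⁻¹ * a y) x := ha.const_mul_lie _
  have hb' : MDifferentiableAt J 𝓘(ℝ, F) (fun y => (b x)⁻¹ * b y) x := hb.const_mul_lie _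
  have hp : MDifferentiableAt 𝓘(ℝ, E) 𝓘(ℝ, F) (fun g : Gt => (b x)⁻¹ * X.act g (b x))
      ((a x)⁻¹ * a x) := (X.mdifferentiable_act_left (b x) _).const_mul_lie (b x)⁻¹
  have h₁ : MDifferentiableAt J 𝓘(ℝ, F) (fun y => (b x)⁻¹ * X.act ((a x)⁻¹ * a y) (b x)) x :=
    hp.comp (f := fun y => (a x)⁻¹ * a y) x ha'
  have h₂ : MDifferentiableAt J 𝓘(ℝ, F)
      (fun y => X.act ((a x)⁻¹ * a y) ((b x)⁻¹ * b y)) x :=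
    (X.mdifferentiable_act₂ ((a x)⁻¹ * a x, (b x)⁻¹ * b x)).comp
      (f := fun y => ((a x)⁻¹ * a y, (b x)⁻¹ * b y)) x
      (ha'.prodMk hb')
  rw [inv_mul_cancel] at hp
  rw [lieLogDeriv, e, modelDeriv_comp (I := 𝓘(ℝ, F)) (ψ := fun h => X.act (a x) h) (y := (1 : H))
      (by simp) (X.mdifferentiable_act _ 1) (h₁.mul_lie h₂), ← dact_eq,
    modelDeriv_mul_of_eq_one (by simp) (by simp) h₁ h₂,
    modelDeriv_comp (I := 𝓘(ℝ, E)) (ψ := fun g : Gt => (b x)⁻¹ * X.act g (b x)) (y := (1 : Gt))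
      (by simp) hp ha', ← dactAt_eq,
    modelDeriv_comp₂ (μ := fun p : Gt × H => X.act p.1 p.2) (y := (1 : Gt)) (z := (1 : H))
      (by simp) (by simp) (X.mdifferentiable_act₂ _) ha' hb']
  simp only [map_one, MulAut.one_apply, modelDeriv_const, modelDeriv_id]
  rw [zero_apply, zero_add, add_comm, lieLogDeriv, lieLogDeriv]

end CentralLieCrossedModule

/-! ### The structure maps of the gerbe in the left trivialization -/

section Projections

variable {E : Type*} [NormedAddCommGroup E] [NormedSpace ℝ E]
  {A : Type*} [TopologicalSpace A] [ChartedSpace E A] [Group A] [LieGroup 𝓘(ℝ, E) ∞ A]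
  {EM : Type*} [NormedAddCommGroup EM] [NormedSpace ℝ EM]
  {HM : Type*} [TopologicalSpace HM] {I : ModelWithCorners ℝ EM HM}
  {M : Type*} [TopologicalSpace M] [ChartedSpace HM M]
  {EN : Type*} [NormedAddCommGroup EN] [NormedSpace ℝ EN]
  {HN : Type*} [TopologicalSpace HN] {J : ModelWithCorners ℝ EN HN}
  {N : Type*} [TopologicalSpace N] [ChartedSpace HN N]

open OneForm (theta)

theorem lieLogDeriv_comp_fst {a : M → A} (ha : MDifferentiable I 𝓘(ℝ, E) a) (p : M × N)
    (w : EM × EN) :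
    lieLogDeriv (E := E) (I.prod J) (fun q : M × N => a q.1) p w = lieLogDeriv I a p.1 w.1 := by
  rw [lieLogDeriv_comp (I := I) (φ := fun q : M × N => q.1) (ha _) mdifferentiableAt_fst]
  exact congrArg _ (modelDeriv_fst p w)

theorem lieLogDeriv_comp_snd {a : N → A} (ha : MDifferentiable J 𝓘(ℝ, E) a) (p : M × N)
    (w : EM × EN) :
    lieLogDeriv (E := E) (I.prod J) (fun q : M × N => a q.2) p w = lieLogDeriv J a p.2 w.2 := by
  rw [lieLogDeriv_comp (I := J) (φ := fun q : M × N => q.2) (ha _) mdifferentiableAt_snd]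
  exact congrArg _ (modelDeriv_snd p w)

theorem lieLogDeriv_fst (p : A × M) (w : E × EM) :
    lieLogDeriv (E := E) (𝓘(ℝ, E).prod I) (fun q : A × M => q.1) p w = theta p.1 w.1 :=
  lieLogDeriv_comp_fst (a := fun x : A => x) mdifferentiable_id p w

theorem lieLogDeriv_snd (p : M × A) (w : EM × E) :
    lieLogDeriv (E := E) (I.prod 𝓘(ℝ, E)) (fun q : M × A => q.2) p w = theta p.2 w.2 :=
  lieLogDeriv_comp_snd (a := fun x : A => x) mdifferentiable_id p w

theorem lieLogDeriv_fst_fst (p : (A × M) × N) (w : (E × EM) × EN) :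
    lieLogDeriv (E := E) ((𝓘(ℝ, E).prod I).prod J) (fun q : (A × M) × N => q.1.1) p w =
      theta p.1.1 w.1.1 := by
  rw [lieLogDeriv_comp_fst (a := fun q : A × M => q.1) mdifferentiable_fst, lieLogDeriv_fst]

theorem lieLogDeriv_fst_snd (p : (M × A) × N) (w : (EM × E) × EN) :
    lieLogDeriv (E := E) ((I.prod 𝓘(ℝ, E)).prod J) (fun q : (M × A) × N => q.1.2) p w =
      theta p.1.2 w.1.2 := by
  rw [lieLogDeriv_comp_fst (a := fun q : M × A => q.2) mdifferentiable_snd, lieLogDeriv_snd]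

theorem lieLogDeriv_snd_fst (p : N × (A × M)) (w : EN × (E × EM)) :
    lieLogDeriv (E := E) (J.prod (𝓘(ℝ, E).prod I)) (fun q : N × (A × M) => q.2.1) p w =
      theta p.2.1 w.2.1 := by
  rw [lieLogDeriv_comp_snd (a := fun q : A × M => q.1) mdifferentiable_fst, lieLogDeriv_fst]

theorem lieLogDeriv_snd_snd (p : N × (M × A)) (w : EN × (EM × E)) :
    lieLogDeriv (E := E) (J.prod (I.prod 𝓘(ℝ, E))) (fun q : N × (M × A) => q.2.2) p w =
      theta p.2.2 w.2.2 := by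
  rw [lieLogDeriv_comp_snd (a := fun q : M × A => q.2) mdifferentiable_snd, lieLogDeriv_snd]

variable {EP : Type*} [NormedAddCommGroup EP] [NormedSpace ℝ EP]
  {HP : Type*} [TopologicalSpace HP] {K : ModelWithCorners ℝ EP HP}
  {P : Type*} [TopologicalSpace P] [ChartedSpace HP P]

theorem mdifferentiableAt_fst_fst (p : (M × N) × P) :
    MDifferentiableAt ((I.prod J).prod K) I (fun q : (M × N) × P => q.1.1) p :=
  mdifferentiableAt_fst.comp (f := fun q : (M × N) × P => q.1) p mdifferentiableAt_fst

theorem mdifferentiableAt_fst_snd (p : (M × N) × P) :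
    MDifferentiableAt ((I.prod J).prod K) J (fun q : (M × N) × P => q.1.2) p :=
  mdifferentiableAt_snd.comp (f := fun q : (M × N) × P => q.1) p mdifferentiableAt_fst

theorem mdifferentiableAt_snd_fst (p : P × (M × N)) :
    MDifferentiableAt (K.prod (I.prod J)) I (fun q : P × (M × N) => q.2.1) p :=
  mdifferentiableAt_fst.comp (f := fun q : P × (M × N) => q.2) p mdifferentiableAt_snd

theorem mdifferentiableAt_snd_snd (p : P × (M × N)) :
    MDifferentiableAt (K.prod (I.prod J)) J (fun q : P × (M × N) => q.2.2) p :=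
  mdifferentiableAt_snd.comp (f := fun q : P × (M × N) => q.2) p mdifferentiableAt_snd

end Projections

namespace CentralLieCrossedModule

open OneForm

variable {E : Type*} [NormedAddCommGroup E] [NormedSpace ℝ E]
  {F : Type*} [NormedAddCommGroup F] [NormedSpace ℝ F]
  {B : Type*} [NormedAddCommGroup B] [NormedSpace ℝ B]
  {Gt : Type*} [TopologicalSpace Gt] [ChartedSpace E Gt] [Group Gt] [LieGroup 𝓘(ℝ, E) ∞ Gt]
  {H : Type*} [TopologicalSpace H] [ChartedSpace F H] [Group H] [LieGroup 𝓘(ℝ, F) ∞ H]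
  {G : Type*} [TopologicalSpace G] [ChartedSpace B G] [Group G]
  (X : CentralLieCrossedModule (E := E) (F := F) (B := B) Gt H G)
  {V : Type*} [NormedAddCommGroup V] [NormedSpace ℝ V]

theorem coord_pullback_src (σ : OneForm 𝓘(ℝ, E) Gt V) (p : Gt × H) (w : E × F) :
    (pullback X.src σ).coord p w = σ.coeff p.1 (theta p.1 w.1) := by
  rw [coord_pullback_eq_coeff]
  exact congrArg _ (lieLogDeriv_fst p w)

theorem coord_pullback_tgt (σ : OneForm 𝓘(ℝ, E) Gt V) (p : Gt × H) (w : E × F) :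
    (pullback X.tgt σ).coord p w =
      σ.coeff (X.f p.2 * p.1) (lieAd p.1⁻¹ (X.df (theta p.2 w.2)) + theta p.1 w.1) := by
  rw [coord_pullback_eq_coeff]
  refine congrArg _ (Eq.trans (lieLogDeriv_mul (a := fun q : Gt × H => X.f q.2)
    (b := fun q : Gt × H => q.1) ?_ mdifferentiableAt_fst w) ?_)
  · exact (X.mdifferentiable_f _).comp p mdifferentiableAt_snd
  · rw [X.lieLogDeriv_f mdifferentiableAt_snd, lieLogDeriv_fst, lieLogDeriv_snd]

theorem coord_pullback_translate (t : H) (α : OneForm (𝓘(ℝ, E).prod 𝓘(ℝ, F)) (Gt × H) V)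
    (p : Gt × H) (w : E × F) :
    (pullback (X.translate t) α).coord p w = α.coeffFst (p.1, p.2 * t) (theta p.1 w.1) +
      α.coeffSnd (p.1, p.2 * t) (lieAd t⁻¹ (theta p.2 w.2)) := by
  rw [coord_pullback_eq_coeff₂]
  refine congrArg₂ _ (congrArg _ (lieLogDeriv_fst p w)) (congrArg _ ?_)
  refine (lieLogDeriv_mul (a := fun q : Gt × H => q.2) (b := fun _ : Gt × H => t)
    mdifferentiableAt_snd mdifferentiableAt_const w).trans ?_
  rw [lieLogDeriv_snd, lieLogDeriv_const, zero_apply, add_zero]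

theorem coord_pullback_orbit (p : Gt × H) (α : OneForm (𝓘(ℝ, E).prod 𝓘(ℝ, F)) (Gt × H) V)
    (u : F) : (pullback (X.orbit p) α).coord 1 u = α.coeffSnd p u := by
  rw [coord_pullback_eq_coeff₂]
  have h₁ : lieLogDeriv (E := E) 𝓘(ℝ, F) (fun y : H => (X.orbit p y).1) 1 = 0 :=
    lieLogDeriv_const p.1 1
  have h₂ : lieLogDeriv (E := F) 𝓘(ℝ, F) (fun y : H => (X.orbit p y).2) 1 u = u :=
    lieLogDeriv_mul_left p.2 u
  have h₃ : X.orbit p 1 = p := congrArg (Prod.mk p.1) (mul_one p.2)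
  rw [h₁, h₂, h₃, zero_apply, map_zero, zero_add]

theorem coord_pullback_pairFst (α : OneForm (𝓘(ℝ, E).prod 𝓘(ℝ, F)) (Gt × H) V)
    (p : Gt × H × H) (w : E × F × F) :
    (pullback X.pairFst α).coord p w = α.coeffFst (p.1, p.2.1) (theta p.1 w.1) +
      α.coeffSnd (p.1, p.2.1) (theta p.2.1 w.2.1) := by
  rw [coord_pullback_eq_coeff₂]
  exact congrArg₂ _ (congrArg _ (lieLogDeriv_fst p w)) (congrArg _ (lieLogDeriv_snd_fst p w))

theorem coord_pullback_pairSnd (α : OneForm (𝓘(ℝ, E).prod 𝓘(ℝ, F)) (Gt × H) V)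
    (p : Gt × H × H) (w : E × F × F) :
    (pullback X.pairSnd α).coord p w =
      α.coeffFst (X.f p.2.1 * p.1, p.2.2)
        (lieAd p.1⁻¹ (X.df (theta p.2.1 w.2.1)) + theta p.1 w.1) +
      α.coeffSnd (X.f p.2.1 * p.1, p.2.2) (theta p.2.2 w.2.2) := by
  rw [coord_pullback_eq_coeff₂]
  have h : MDifferentiableAt (𝓘(ℝ, E).prod (𝓘(ℝ, F).prod 𝓘(ℝ, F))) 𝓘(ℝ, F)
      (fun q : Gt × H × H => q.2.1) p := mdifferentiableAt_snd_fst p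
  have h' : MDifferentiableAt (𝓘(ℝ, E).prod (𝓘(ℝ, F).prod 𝓘(ℝ, F))) 𝓘(ℝ, E)
      (fun q : Gt × H × H => X.f q.2.1) p :=
    (X.mdifferentiable_f _).comp p h
  refine congrArg₂ _ (congrArg _ ?_) (congrArg _ (lieLogDeriv_snd_snd p w))
  refine (lieLogDeriv_mul (b := fun q : Gt × H × H => q.1) h' mdifferentiableAt_fst w).trans ?_
  rw [X.lieLogDeriv_f h, lieLogDeriv_fst, lieLogDeriv_snd_fst]

theorem coord_pullback_gerbeProd (α : OneForm (𝓘(ℝ, E).prod 𝓘(ℝ, F)) (Gt × H) V)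
    (p : Gt × H × H) (w : E × F × F) :
    (pullback X.gerbeProd α).coord p w =
      α.coeffFst (p.1, p.2.2 * p.2.1) (theta p.1 w.1) +
      α.coeffSnd (p.1, p.2.2 * p.2.1)
        (lieAd p.2.1⁻¹ (theta p.2.2 w.2.2) + theta p.2.1 w.2.1) := by
  rw [coord_pullback_eq_coeff₂]
  refine congrArg₂ _ (congrArg _ (lieLogDeriv_fst p w)) (congrArg _ ?_)
  refine (lieLogDeriv_mul (a := fun q : Gt × H × H => q.2.2) (b := fun q : Gt × H × H => q.2.1)
    (mdifferentiableAt_snd_snd p) (mdifferentiableAt_snd_fst p) w).trans ?_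
  rw [lieLogDeriv_snd_snd, lieLogDeriv_snd_fst]

theorem coord_pullback_fstL (α : OneForm (𝓘(ℝ, E).prod 𝓘(ℝ, F)) (Gt × H) V)
    (p : (Gt × H) × (Gt × H)) (w : (E × F) × (E × F)) :
    (pullback X.fstL α).coord p w = α.coeffFst p.1 (theta p.1.1 w.1.1) +
      α.coeffSnd p.1 (theta p.1.2 w.1.2) := by
  rw [coord_pullback_eq_coeff₂]
  exact congrArg₂ _ (congrArg _ (lieLogDeriv_fst_fst p w)) (congrArg _ (lieLogDeriv_fst_snd p w))

theorem coord_pullback_sndL (α : OneForm (𝓘(ℝ, E).prod 𝓘(ℝ, F)) (Gt × H) V)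
    (p : (Gt × H) × (Gt × H)) (w : (E × F) × (E × F)) :
    (pullback X.sndL α).coord p w = α.coeffFst p.2 (theta p.2.1 w.2.1) +
      α.coeffSnd p.2 (theta p.2.2 w.2.2) := by
  rw [coord_pullback_eq_coeff₂]
  exact congrArg₂ _ (congrArg _ (lieLogDeriv_snd_fst p w)) (congrArg _ (lieLogDeriv_snd_snd p w))

theorem coord_pullback_mulL (α : OneForm (𝓘(ℝ, E).prod 𝓘(ℝ, F)) (Gt × H) V)
    (p : (Gt × H) × (Gt × H)) (w : (E × F) × (E × F)) :
    (pullback X.mulL α).coord p w =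
      α.coeffFst (p.1.1 * p.2.1, p.1.2 * X.act p.1.1 p.2.2)
        (lieAd p.2.1⁻¹ (theta p.1.1 w.1.1) + theta p.2.1 w.2.1) +
      α.coeffSnd (p.1.1 * p.2.1, p.1.2 * X.act p.1.1 p.2.2)
        (lieAd (X.act p.1.1 p.2.2)⁻¹ (theta p.1.2 w.1.2) +
          X.dact p.1.1 (theta p.2.2 w.2.2 + X.dactAt p.2.2 (theta p.1.1 w.1.1))) := by
  rw [coord_pullback_eq_coeff₂]
  have h₁ : MDifferentiableAt ((𝓘(ℝ, E).prod 𝓘(ℝ, F)).prod (𝓘(ℝ, E).prod 𝓘(ℝ, F))) 𝓘(ℝ, E)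
      (fun q : (Gt × H) × (Gt × H) => q.1.1) p := mdifferentiableAt_fst_fst p
  have h₂ : MDifferentiableAt ((𝓘(ℝ, E).prod 𝓘(ℝ, F)).prod (𝓘(ℝ, E).prod 𝓘(ℝ, F))) 𝓘(ℝ, F)
      (fun q : (Gt × H) × (Gt × H) => q.2.2) p := mdifferentiableAt_snd_snd p
  have h₃ : MDifferentiableAt ((𝓘(ℝ, E).prod 𝓘(ℝ, F)).prod (𝓘(ℝ, E).prod 𝓘(ℝ, F))) 𝓘(ℝ, F)
      (fun q : (Gt × H) × (Gt × H) => X.act q.1.1 q.2.2) p :=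
    (X.mdifferentiable_act₂ (p.1.1, p.2.2)).comp
      (f := fun q : (Gt × H) × (Gt × H) => (q.1.1, q.2.2)) p (h₁.prodMk h₂)
  refine congrArg₂ _ (congrArg _ ?_) (congrArg _ ?_)
  · refine (lieLogDeriv_mul (b := fun q : (Gt × H) × (Gt × H) => q.2.1) h₁
      (mdifferentiableAt_snd_fst p) w).trans ?_
    rw [lieLogDeriv_fst_fst, lieLogDeriv_snd_fst]
  · refine (lieLogDeriv_mul (a := fun q : (Gt × H) × (Gt × H) => q.1.2)
      (mdifferentiableAt_fst_snd p) h₃ w).trans ?_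
    rw [X.lieLogDeriv_act h₁ h₂, lieLogDeriv_fst_fst, lieLogDeriv_fst_snd, lieLogDeriv_snd_snd]

theorem coord_pullback_src₂ (α : OneForm (𝓘(ℝ, E).prod 𝓘(ℝ, E)) (Gt × Gt) V)
    (p : (Gt × H) × (Gt × H)) (w : (E × F) × (E × F)) :
    (pullback X.src₂ α).coord p w = α.coeffFst (p.1.1, p.2.1) (theta p.1.1 w.1.1) +
      α.coeffSnd (p.1.1, p.2.1) (theta p.2.1 w.2.1) := by
  rw [coord_pullback_eq_coeff₂]
  exact congrArg₂ _ (congrArg _ (lieLogDeriv_fst_fst p w)) (congrArg _ (lieLogDeriv_snd_fst p w))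

theorem coord_pullback_tgt₂ (α : OneForm (𝓘(ℝ, E).prod 𝓘(ℝ, E)) (Gt × Gt) V)
    (p : (Gt × H) × (Gt × H)) (w : (E × F) × (E × F)) :
    (pullback X.tgt₂ α).coord p w =
      α.coeffFst (X.f p.1.2 * p.1.1, X.f p.2.2 * p.2.1)
        (lieAd p.1.1⁻¹ (X.df (theta p.1.2 w.1.2)) + theta p.1.1 w.1.1) +
      α.coeffSnd (X.f p.1.2 * p.1.1, X.f p.2.2 * p.2.1)
        (lieAd p.2.1⁻¹ (X.df (theta p.2.2 w.2.2)) + theta p.2.1 w.2.1) := by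
  rw [coord_pullback_eq_coeff₂]
  have h₁ : MDifferentiableAt ((𝓘(ℝ, E).prod 𝓘(ℝ, F)).prod (𝓘(ℝ, E).prod 𝓘(ℝ, F))) 𝓘(ℝ, F)
      (fun q : (Gt × H) × (Gt × H) => q.1.2) p := mdifferentiableAt_fst_snd p
  have h₂ : MDifferentiableAt ((𝓘(ℝ, E).prod 𝓘(ℝ, F)).prod (𝓘(ℝ, E).prod 𝓘(ℝ, F))) 𝓘(ℝ, F)
      (fun q : (Gt × H) × (Gt × H) => q.2.2) p := mdifferentiableAt_snd_snd p
  refine congrArg₂ _ (congrArg _ ?_) (congrArg _ ?_)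
  · refine (lieLogDeriv_mul (a := fun q : (Gt × H) × (Gt × H) => X.f q.1.2)
      (b := fun q : (Gt × H) × (Gt × H) => q.1.1) ((X.mdifferentiable_f _).comp p h₁)
      (mdifferentiableAt_fst_fst p) w).trans ?_
    rw [X.lieLogDeriv_f h₁, lieLogDeriv_fst_fst, lieLogDeriv_fst_snd]
  · refine (lieLogDeriv_mul (a := fun q : (Gt × H) × (Gt × H) => X.f q.2.2)
      (b := fun q : (Gt × H) × (Gt × H) => q.2.1) ((X.mdifferentiable_f _).comp p h₂)
      (mdifferentiableAt_snd_fst p) w).trans ?_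
    rw [X.lieLogDeriv_f h₂, lieLogDeriv_snd_fst, lieLogDeriv_snd_snd]

theorem coord_pullback_face₁ (σ : OneForm 𝓘(ℝ, E) Gt V) (p : Gt × Gt) (w : E × E) :
    (pullback X.face₁ σ).coord p w = σ.coeff p.1 (theta p.1 w.1) := by
  rw [coord_pullback_eq_coeff]
  exact congrArg _ (lieLogDeriv_fst p w)

theorem coord_pullback_face₂ (σ : OneForm 𝓘(ℝ, E) Gt V) (p : Gt × Gt) (w : E × E) :
    (pullback X.face₂ σ).coord p w = σ.coeff p.2 (theta p.2 w.2) := by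
  rw [coord_pullback_eq_coeff]
  exact congrArg _ (lieLogDeriv_snd p w)

theorem coord_pullback_face₁₂ (σ : OneForm 𝓘(ℝ, E) Gt V) (p : Gt × Gt) (w : E × E) :
    (pullback X.face₁₂ σ).coord p w =
      σ.coeff (p.1 * p.2) (lieAd p.2⁻¹ (theta p.1 w.1) + theta p.2 w.2) := by
  rw [coord_pullback_eq_coeff]
  refine congrArg _ ((lieLogDeriv_mul (a := fun q : Gt × Gt => q.1) (b := fun q : Gt × Gt => q.2)
    mdifferentiableAt_fst mdifferentiableAt_snd w).trans ?_)
  rw [lieLogDeriv_fst, lieLogDeriv_snd]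

theorem coord_pullback_face_1_2 (α : OneForm (𝓘(ℝ, E).prod 𝓘(ℝ, E)) (Gt × Gt) V)
    (p : Gt × Gt × Gt) (w : E × E × E) :
    (pullback X.face_1_2 α).coord p w = α.coeffFst (p.1, p.2.1) (theta p.1 w.1) +
      α.coeffSnd (p.1, p.2.1) (theta p.2.1 w.2.1) := by
  rw [coord_pullback_eq_coeff₂]
  exact congrArg₂ _ (congrArg _ (lieLogDeriv_fst p w)) (congrArg _ (lieLogDeriv_snd_fst p w))

theorem coord_pullback_face_2_3 (α : OneForm (𝓘(ℝ, E).prod 𝓘(ℝ, E)) (Gt × Gt) V)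
    (p : Gt × Gt × Gt) (w : E × E × E) :
    (pullback X.face_2_3 α).coord p w = α.coeffFst (p.2.1, p.2.2) (theta p.2.1 w.2.1) +
      α.coeffSnd (p.2.1, p.2.2) (theta p.2.2 w.2.2) := by
  rw [coord_pullback_eq_coeff₂]
  exact congrArg₂ _ (congrArg _ (lieLogDeriv_snd_fst p w)) (congrArg _ (lieLogDeriv_snd_snd p w))

theorem coord_pullback_face_12_3 (α : OneForm (𝓘(ℝ, E).prod 𝓘(ℝ, E)) (Gt × Gt) V)
    (p : Gt × Gt × Gt) (w : E × E × E) :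
    (pullback X.face_12_3 α).coord p w =
      α.coeffFst (p.1 * p.2.1, p.2.2)
        (lieAd p.2.1⁻¹ (theta p.1 w.1) + theta p.2.1 w.2.1) +
      α.coeffSnd (p.1 * p.2.1, p.2.2) (theta p.2.2 w.2.2) := by
  rw [coord_pullback_eq_coeff₂]
  refine congrArg₂ _ (congrArg _ ?_) (congrArg _ (lieLogDeriv_snd_snd p w))
  refine (lieLogDeriv_mul (a := fun q : Gt × Gt × Gt => q.1)
    (b := fun q : Gt × Gt × Gt => q.2.1) mdifferentiableAt_fst
    (mdifferentiableAt_snd_fst p) w).trans ?_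
  rw [lieLogDeriv_fst, lieLogDeriv_snd_fst]

theorem coord_pullback_face_1_23 (α : OneForm (𝓘(ℝ, E).prod 𝓘(ℝ, E)) (Gt × Gt) V)
    (p : Gt × Gt × Gt) (w : E × E × E) :
    (pullback X.face_1_23 α).coord p w =
      α.coeffFst (p.1, p.2.1 * p.2.2) (theta p.1 w.1) +
      α.coeffSnd (p.1, p.2.1 * p.2.2)
        (lieAd p.2.2⁻¹ (theta p.2.1 w.2.1) + theta p.2.2 w.2.2) := by
  rw [coord_pullback_eq_coeff₂]
  refine congrArg₂ _ (congrArg _ (lieLogDeriv_fst p w)) (congrArg _ ?_)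
  refine (lieLogDeriv_mul (a := fun q : Gt × Gt × Gt => q.2.1)
    (b := fun q : Gt × Gt × Gt => q.2.2) (mdifferentiableAt_snd_fst p)
    (mdifferentiableAt_snd_snd p) w).trans ?_
  rw [lieLogDeriv_snd_fst, lieLogDeriv_snd_snd]

end CentralLieCrossedModule

/-! ### From strong adjustments to connective structures -/

namespace CentralLieCrossedModule

open OneForm

variable {E : Type*} [NormedAddCommGroup E] [NormedSpace ℝ E]
  {F : Type*} [NormedAddCommGroup F] [NormedSpace ℝ F]
  {B : Type*} [NormedAddCommGroup B] [NormedSpace ℝ B]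
  {Gt : Type*} [TopologicalSpace Gt] [ChartedSpace E Gt] [Group Gt] [LieGroup 𝓘(ℝ, E) ∞ Gt]
  {H : Type*} [TopologicalSpace H] [ChartedSpace F H] [Group H] [LieGroup 𝓘(ℝ, F) ∞ H]
  {G : Type*} [TopologicalSpace G] [ChartedSpace B G] [Group G]
  (X : CentralLieCrossedModule (E := E) (F := F) (B := B) Gt H G)
  {V : Type*} [NormedAddCommGroup V] [NormedSpace ℝ V]

/-- Flatness of the gerbe product, read on coefficients. -/
theorem gerbeProd_flat_iff (α : OneForm (𝓘(ℝ, E).prod 𝓘(ℝ, F)) (Gt × H) V) :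
    pullback X.gerbeProd α = pullback X.pairFst α + pullback X.pairSnd α ↔
      ∀ (g : Gt) (h h' : H) (v : E) (u u' : F),
        α.coeffFst (g, h' * h) v + α.coeffSnd (g, h' * h) (lieAd h⁻¹ u' + u) =
          α.coeffFst (g, h) v + α.coeffSnd (g, h) u +
          (α.coeffFst (X.f h * g, h') (lieAd g⁻¹ (X.df u) + v) +
            α.coeffSnd (X.f h * g, h') u') := by
  constructor
  · intro e g h h' v u u'
    have := congrArg (fun γ => γ.coord (g, h, h')
      (leftTranslation g v, leftTranslation h u, leftTranslation h' u')) e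
    simpa only [coord_add, X.coord_pullback_gerbeProd, X.coord_pullback_pairFst,
      X.coord_pullback_pairSnd, theta_leftTranslation] using this
  · intro e
    refine ext_coord fun p w => ?_
    rw [coord_add, X.coord_pullback_gerbeProd, X.coord_pullback_pairFst,
      X.coord_pullback_pairSnd]
    exact e _ _ _ _ _ _

/-- The condition on a connection on the multiplication, read on coefficients: `v₁, v₂` and
`u₁, u₂` are the logarithmic derivatives of `g₁, g₂` and `h₁, h₂`. -/
theorem mConn_isConnection_iff (α : OneForm (𝓘(ℝ, E).prod 𝓘(ℝ, F)) (Gt × H) V)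
    (τ : OneForm (𝓘(ℝ, E).prod 𝓘(ℝ, E)) (Gt × Gt) V) :
    pullback X.tgt₂ τ - pullback X.src₂ τ =
        pullback X.mulL α - (pullback X.fstL α + pullback X.sndL α) ↔
      ∀ (g₁ g₂ : Gt) (h₁ h₂ : H) (v₁ v₂ : E) (u₁ u₂ : F),
        τ.coeffFst (X.f h₁ * g₁, X.f h₂ * g₂) (lieAd g₁⁻¹ (X.df u₁) + v₁) +
            τ.coeffSnd (X.f h₁ * g₁, X.f h₂ * g₂) (lieAd g₂⁻¹ (X.df u₂) + v₂) -
          (τ.coeffFst (g₁, g₂) v₁ + τ.coeffSnd (g₁, g₂) v₂) =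
        α.coeffFst (g₁ * g₂, h₁ * X.act g₁ h₂) (lieAd g₂⁻¹ v₁ + v₂) +
            α.coeffSnd (g₁ * g₂, h₁ * X.act g₁ h₂)
              (lieAd (X.act g₁ h₂)⁻¹ u₁ + X.dact g₁ (u₂ + X.dactAt h₂ v₁)) -
          (α.coeffFst (g₁, h₁) v₁ + α.coeffSnd (g₁, h₁) u₁ +
            (α.coeffFst (g₂, h₂) v₂ + α.coeffSnd (g₂, h₂) u₂)) := by
  constructor
  · intro e g₁ g₂ h₁ h₂ v₁ v₂ u₁ u₂
    have := congrArg (fun γ => γ.coord ((g₁, h₁), (g₂, h₂))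
      ((leftTranslation g₁ v₁, leftTranslation h₁ u₁),
        (leftTranslation g₂ v₂, leftTranslation h₂ u₂))) e
    simpa only [coord_add, coord_sub, X.coord_pullback_tgt₂, X.coord_pullback_src₂,
      X.coord_pullback_mulL, X.coord_pullback_fstL, X.coord_pullback_sndL,
      theta_leftTranslation] using this
  · intro e
    refine ext_coord fun p w => ?_
    rw [coord_sub, coord_sub, coord_add, X.coord_pullback_tgt₂, X.coord_pullback_src₂,
      X.coord_pullback_mulL, X.coord_pullback_fstL, X.coord_pullback_sndL]
    exact e _ _ _ _ _ _ _ _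

/-- Flatness of the associator, read on coefficients. It says that the coefficients form a cocycle
in the simplicial complex of 1-forms on the powers of `Gt`. -/
theorem assoc_flat_iff (τ : OneForm (𝓘(ℝ, E).prod 𝓘(ℝ, E)) (Gt × Gt) V) :
    pullback X.face_1_2 τ + pullback X.face_12_3 τ =
        pullback X.face_1_23 τ + pullback X.face_2_3 τ ↔
      ∀ (g₁ g₂ g₃ : Gt) (v₁ v₂ v₃ : E),
        τ.coeffFst (g₁, g₂) v₁ + τ.coeffSnd (g₁, g₂) v₂ +
          (τ.coeffFst (g₁ * g₂, g₃) (lieAd g₂⁻¹ v₁ + v₂) + τ.coeffSnd (g₁ * g₂, g₃) v₃) =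
        τ.coeffFst (g₁, g₂ * g₃) v₁ + τ.coeffSnd (g₁, g₂ * g₃) (lieAd g₃⁻¹ v₂ + v₃) +
          (τ.coeffFst (g₂, g₃) v₂ + τ.coeffSnd (g₂, g₃) v₃) := by
  constructor
  · intro e g₁ g₂ g₃ v₁ v₂ v₃
    have := congrArg (fun γ => γ.coord (g₁, g₂, g₃)
      (leftTranslation g₁ v₁, leftTranslation g₂ v₂, leftTranslation g₃ v₃)) e
    simpa only [coord_add, X.coord_pullback_face_1_2, X.coord_pullback_face_12_3,
      X.coord_pullback_face_1_23, X.coord_pullback_face_2_3, theta_leftTranslation] using this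
  · intro e
    refine ext_coord fun p w => ?_
    rw [coord_add, coord_add, X.coord_pullback_face_1_2, X.coord_pullback_face_12_3,
      X.coord_pullback_face_1_23, X.coord_pullback_face_2_3]
    exact e _ _ _ _ _ _

/-- The first condition on an isomorphism of connective structures, read on coefficients. -/
theorem iso_isConnection_iff (α₁ α₂ : OneForm (𝓘(ℝ, E).prod 𝓘(ℝ, F)) (Gt × H) V)
    (σ : OneForm 𝓘(ℝ, E) Gt V) :
    α₂ - α₁ = pullback X.tgt σ - pullback X.src σ ↔
      ∀ (g : Gt) (h : H) (v : E) (u : F),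
        α₂.coeffFst (g, h) v + α₂.coeffSnd (g, h) u -
            (α₁.coeffFst (g, h) v + α₁.coeffSnd (g, h) u) =
          σ.coeff (X.f h * g) (lieAd g⁻¹ (X.df u) + v) - σ.coeff g v := by
  constructor
  · intro e g h v u
    have := congrArg (fun γ => γ.coord (g, h) (leftTranslation g v, leftTranslation h u)) e
    simpa only [coord_sub, X.coord_pullback_tgt, X.coord_pullback_src,
      coord_eq_coeff₂, theta_leftTranslation] using this
  · intro e
    refine ext_coord fun p w => ?_
    rw [coord_sub, coord_sub, X.coord_pullback_tgt, X.coord_pullback_src, coord_eq_coeff₂,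
      coord_eq_coeff₂]
    exact e _ _ _ _

/-- The second condition on an isomorphism of connective structures, read on coefficients. -/
theorem iso_square_iff (τ₁ τ₂ : OneForm (𝓘(ℝ, E).prod 𝓘(ℝ, E)) (Gt × Gt) V)
    (σ : OneForm 𝓘(ℝ, E) Gt V) :
    τ₁ + pullback X.face₁₂ σ = (pullback X.face₁ σ + pullback X.face₂ σ) + τ₂ ↔
      ∀ (g₁ g₂ : Gt) (v₁ v₂ : E),
        τ₁.coeffFst (g₁, g₂) v₁ + τ₁.coeffSnd (g₁, g₂) v₂ +
            σ.coeff (g₁ * g₂) (lieAd g₂⁻¹ v₁ + v₂) =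
          σ.coeff g₁ v₁ + σ.coeff g₂ v₂ +
            (τ₂.coeffFst (g₁, g₂) v₁ + τ₂.coeffSnd (g₁, g₂) v₂) := by
  constructor
  · intro e g₁ g₂ v₁ v₂
    have := congrArg (fun γ => γ.coord (g₁, g₂) (leftTranslation g₁ v₁, leftTranslation g₂ v₂)) e
    simpa only [coord_add, X.coord_pullback_face₁₂, X.coord_pullback_face₁,
      X.coord_pullback_face₂, coord_eq_coeff₂, theta_leftTranslation] using this
  · intro e
    refine ext_coord fun p w => ?_
    rw [coord_add, coord_add, coord_add, X.coord_pullback_face₁₂, X.coord_pullback_face₁,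
      X.coord_pullback_face₂, coord_eq_coeff₂, coord_eq_coeff₂]
    exact e _ _ _ _

variable {X}

namespace StrongAdjustment

variable (a : X.StrongAdjustment)

/-- The twisted splitting `s + κ(g) ∘ f`. -/
def connCoeff (g : Gt) : F →L[ℝ] X.lieT := a.s + (a.κ g).comp X.df

/-- The two expressions of `connCoeff`: `s + κ(g) ∘ f` is visibly smooth in `g`, while `s(g⁻¹ ▷ u)`
is the one suited to computations. -/
theorem connCoeff_apply (g : Gt) (u : F) : a.connCoeff g u = a.s (X.dact g⁻¹ u) := by
  rw [connCoeff, add_apply, ContinuousLinearMap.comp_apply, a.κ_df, map_sub,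
    add_sub_cancel]

theorem contMDiff_connCoeff :
    ContMDiff 𝓘(ℝ, E) 𝓘(ℝ, F →L[ℝ] X.lieT) ∞ a.connCoeff :=
  contMDiff_const.add (a.smooth_κ.clm_comp contMDiff_const)

/-- The connection `s(g⁻¹ ▷ h⁻¹ dh)` on the principal bundle `L` defined by a strong adjustment. -/
def conn : OneForm (𝓘(ℝ, E).prod 𝓘(ℝ, F)) (Gt × H) X.lieT :=
  (pullback ContMDiffMap.snd (maurerCartan F H)).clmComp (fun p => a.connCoeff p.1)
    (a.contMDiff_connCoeff.comp contMDiff_fst)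

/-- The connection `κ(g₂, g₁⁻¹ dg₁)` on the multiplication defined by a strong adjustment. -/
def mConn : OneForm (𝓘(ℝ, E).prod 𝓘(ℝ, E)) (Gt × Gt) X.lieT :=
  (pullback ContMDiffMap.fst (maurerCartan E Gt)).clmComp (fun p => a.κ p.2)
    (a.smooth_κ.comp contMDiff_snd)

theorem coord_conn (p : Gt × H) (w : E × F) :
    a.conn.coord p w = a.connCoeff p.1 (theta p.2 w.2) := by
  rw [conn, coord_clmComp, pullback_maurerCartan]
  exact congrArg _ (lieLogDeriv_snd p w)

theorem coord_mConn (p : Gt × Gt) (w : E × E) :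
    a.mConn.coord p w = a.κ p.2 (theta p.1 w.1) := by
  rw [mConn, coord_clmComp, pullback_maurerCartan]
  exact congrArg _ (lieLogDeriv_fst p w)

theorem coeffFst_conn (p : Gt × H) : a.conn.coeffFst p = 0 := by
  ext1 v
  rw [coeffFst_apply, coord_conn, map_zero, map_zero, zero_apply]

theorem coeffSnd_conn (p : Gt × H) : a.conn.coeffSnd p = a.connCoeff p.1 := by
  ext1 u
  rw [coeffSnd_apply, coord_conn, theta_leftTranslation]

theorem coeffFst_mConn (p : Gt × Gt) : a.mConn.coeffFst p = a.κ p.2 := by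
  ext1 v
  rw [coeffFst_apply, coord_mConn, theta_leftTranslation]

theorem coeffSnd_mConn (p : Gt × Gt) : a.mConn.coeffSnd p = 0 := by
  ext1 v
  rw [coeffSnd_apply, coord_mConn, map_zero, map_zero, zero_apply]

/-- The connective structure defined by a strong adjustment. -/
def toConnectiveStructure : X.ConnectiveStructure where
  conn := a.conn
  conn_translate t ht := by
    refine ext_coord fun p w => ?_
    -- `t` acts trivially on `Lie H`, since it is mapped to the identity of `Gt`.
    have hl : lieAd t⁻¹ (theta p.2 w.2) = theta p.2 w.2 := by
      rw [X.lieAd_eq_dact, map_inv, MonoidHom.mem_ker.1 ht, inv_one, dact_one]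
    rw [X.coord_pullback_translate, a.coeffFst_conn, a.coeffSnd_conn, zero_apply, zero_add,
      coord_conn, hl]
  conn_fundamental p u := by
    have hu : X.df (u : F) = 0 := u.2
    refine (X.coord_pullback_orbit p a.conn u).trans ?_
    rw [a.coeffSnd_conn, connCoeff, add_apply, a.s_splits,
      ContinuousLinearMap.comp_apply, hu, map_zero, add_zero]
  conn_gerbeProd := by
    refine (X.gerbeProd_flat_iff _).2 fun g h h' v u u' => ?_
    simp only [coeffFst_conn, coeffSnd_conn, zero_apply, zero_add, map_add]
    rw [add_comm, a.connCoeff_apply g (lieAd h⁻¹ u'), a.connCoeff_apply (X.f h * g),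
      X.lieAd_eq_dact, mul_inv_rev, X.dact_mul, map_inv]
  mConn := a.mConn
  mConn_isConnection := by
    refine (X.mConn_isConnection_iff _ _).2 fun g₁ g₂ h₁ h₂ v₁ v₂ u₁ u₂ => ?_
    simp only [coeffFst_conn, coeffSnd_conn, coeffFst_mConn, coeffSnd_mConn, zero_apply, zero_add,
      add_zero, map_add]
    have e₁ : a.κ (X.f h₂ * g₂) v₁ - a.κ g₂ v₁ = a.s (X.dact g₂⁻¹ (X.dactAt h₂ v₁)) := by
      have e := a.κ_df g₂ (X.dactAt h₂ v₁)
      rw [X.df_dactAt, map_sub, map_sub] at e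
      rw [a.κ_mul, a.κ_f, add_sub_right_comm, e, sub_add_cancel]
    have e₂ : X.dact (g₁ * g₂)⁻¹ (lieAd (X.act g₁ h₂)⁻¹ u₁) =
        X.dact (X.f h₂ * g₂)⁻¹ (X.dact g₁⁻¹ u₁) := by
      rw [X.lieAd_eq_dact, ← X.dact_mul, ← X.dact_mul, map_inv, X.f_act]
      congr 2
      group
    have e₃ (u : F) : X.dact (g₁ * g₂)⁻¹ (X.dact g₁ u) = X.dact g₂⁻¹ u := by
      rw [← X.dact_mul]
      congr 2
      group
    simp only [connCoeff_apply, e₂, e₃]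
    rw [X.lieAd_df, a.κ_df, ← e₁, map_sub]
    abel
  assoc_flat := by
    refine (X.assoc_flat_iff _).2 fun g₁ g₂ g₃ v₁ v₂ v₃ => ?_
    simp only [coeffFst_mConn, coeffSnd_mConn, zero_apply, add_zero, map_add]
    rw [a.κ_mul]
    abel

theorem toConnectiveStructure_conn : a.toConnectiveStructure.conn = a.conn := rfl

theorem toConnectiveStructure_mConn : a.toConnectiveStructure.mConn = a.mConn := rfl

variable {a} {b : X.StrongAdjustment}

/-- The left-invariant 1-form `φ(g⁻¹ dg)` is an isomorphism between the connective structures of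
two strong adjustments if `φ` is an isomorphism between the adjustments. -/
def mapIso (φ : a ⟶ b) : a.toConnectiveStructure ⟶ b.toConnectiveStructure where
  form := (maurerCartan E Gt).clmComp (fun _ => φ.φ) contMDiff_const
  isConnection := by
    refine (X.iso_isConnection_iff _ _ _).2 fun g h v u => ?_
    simp only [toConnectiveStructure_conn, coeffFst_conn, coeffSnd_conn,
      coeff_clmComp_maurerCartan, connCoeff_apply, zero_apply, zero_add]
    rw [φ.s_sub, map_add, X.lieAd_df, add_sub_cancel_right]
  square := by
    refine (X.iso_square_iff _ _ _).2 fun g₁ g₂ v₁ v₂ => ?_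
    simp only [toConnectiveStructure_mConn, coeffFst_mConn, coeffSnd_mConn,
      coeff_clmComp_maurerCartan, zero_apply, add_zero]
    have e := φ.κ_sub g₂ v₁
    rw [map_sub, sub_eq_iff_eq_add] at e
    rw [e, map_add]
    abel

theorem coeff_mapIso (φ : a ⟶ b) (g : Gt) : (mapIso φ).form.coeff g = φ.φ :=
  coeff_clmComp_maurerCartan contMDiff_const g

/-- Every isomorphism between the connective structures of strong adjustments is left-invariant,
because the connections on the multiplication have no component along the second factor. -/
theorem coeff_eq_coeff_one (σ : a.toConnectiveStructure ⟶ b.toConnectiveStructure) (g : Gt) :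
    σ.form.coeff g = σ.form.coeff 1 := by
  ext1 v
  have e := (X.iso_square_iff _ _ _).1 σ.square g 1 0 v
  simpa only [toConnectiveStructure_mConn, coeffSnd_mConn, zero_apply, add_zero, map_zero,
    zero_add, mul_one] using e

/-- The isomorphism of strong adjustments defined by an isomorphism of connective structures. -/
def preimageIso (σ : a.toConnectiveStructure ⟶ b.toConnectiveStructure) : a ⟶ b where
  φ := σ.form.coeff 1
  s_sub u := by
    have e := (X.iso_isConnection_iff _ _ _).1 σ.isConnection 1 1 0 u
    simpa only [toConnectiveStructure_conn, coeffFst_conn, coeffSnd_conn, connCoeff_apply,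
      zero_apply, zero_add, inv_one, X.dact_one, lieAd_one, map_one, mul_one, add_zero, map_zero,
      sub_zero] using e
  κ_sub g v := by
    have e := (X.iso_square_iff _ _ _).1 σ.square 1 g v 0
    simp only [toConnectiveStructure_mConn, coeffFst_mConn, coeffSnd_mConn, add_zero,
      map_zero, coeff_eq_coeff_one] at e
    rw [map_sub, sub_eq_sub_iff_add_eq_add, add_comm, ← e, add_comm]

variable (X) in
/-- The functor sending `(s, κ)` to `(s(g⁻¹ ▷ h⁻¹ dh), κ(g₂, g₁⁻¹ dg₁))` and `φ` to `φ(g⁻¹ dg)`. -/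
def toConnectiveStructureFunctor : X.StrongAdjustment ⥤ X.ConnectiveStructure where
  obj a := a.toConnectiveStructure
  map φ := mapIso φ
  map_id _ := ConnectiveStructure.Iso.ext rfl
  map_comp _ _ := ConnectiveStructure.Iso.ext rfl

instance : (toConnectiveStructureFunctor X).Faithful where
  map_injective {_ _ φ ψ} h := by
    refine StrongAdjustment.Iso.ext ?_
    rw [← coeff_mapIso φ 1, ← coeff_mapIso ψ 1]
    exact congrArg (fun σ => σ.form.coeff 1) h

instance : (toConnectiveStructureFunctor X).Full where
  map_surjective σ := ⟨preimageIso σ, ConnectiveStructure.Iso.ext <| ext_coeff fun g =>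
    (coeff_mapIso (preimageIso σ) g).trans (coeff_eq_coeff_one σ g).symm⟩

end StrongAdjustment

end CentralLieCrossedModule

/-! ### Normalization of connective structures -/

namespace OneForm

variable {EM : Type*} [NormedAddCommGroup EM] [NormedSpace ℝ EM]
  {HM : Type*} [TopologicalSpace HM] {I : ModelWithCorners ℝ EM HM}
  {M : Type*} [TopologicalSpace M] [ChartedSpace HM M] [IsManifold I ∞ M]
  {EN : Type*} [NormedAddCommGroup EN] [NormedSpace ℝ EN]
  {HN : Type*} [TopologicalSpace HN] {J : ModelWithCorners ℝ EN HN}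
  {N : Type*} [TopologicalSpace N] [ChartedSpace HN N] [IsManifold J ∞ N]
  {EN' : Type*} [NormedAddCommGroup EN'] [NormedSpace ℝ EN']
  {HN' : Type*} [TopologicalSpace HN'] {J' : ModelWithCorners ℝ EN' HN'}
  {N' : Type*} [TopologicalSpace N'] [ChartedSpace HN' N'] [IsManifold J' ∞ N']
  {EP : Type*} [NormedAddCommGroup EP] [NormedSpace ℝ EP]
  {HP : Type*} [TopologicalSpace HP] {K : ModelWithCorners ℝ EP HP}
  {P : Type*} [TopologicalSpace P] [ChartedSpace HP P] [IsManifold K ∞ P]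
  {V : Type*} [NormedAddCommGroup V] [NormedSpace ℝ V]

/-- A commutative square of smooth maps gives equal iterated pullbacks. -/
theorem pullback_pullback_congr {φ : C^∞⟮J, N; I, M⟯} {ψ : C^∞⟮K, P; J, N⟯}
    {φ' : C^∞⟮J', N'; I, M⟯} {ψ' : C^∞⟮K, P; J', N'⟯} (h : ∀ x, φ (ψ x) = φ' (ψ' x))
    (α : OneForm I M V) : pullback ψ (pullback φ α) = pullback ψ' (pullback φ' α) := by
  have e : φ.comp ψ = φ'.comp ψ' := ContMDiffMap.ext h
  rw [pullback_pullback, pullback_pullback, e]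

end OneForm

namespace CentralLieCrossedModule

open OneForm

variable {E : Type*} [NormedAddCommGroup E] [NormedSpace ℝ E]
  {F : Type*} [NormedAddCommGroup F] [NormedSpace ℝ F]
  {B : Type*} [NormedAddCommGroup B] [NormedSpace ℝ B]
  {Gt : Type*} [TopologicalSpace Gt] [ChartedSpace E Gt] [Group Gt] [LieGroup 𝓘(ℝ, E) ∞ Gt]
  {H : Type*} [TopologicalSpace H] [ChartedSpace F H] [Group H] [LieGroup 𝓘(ℝ, F) ∞ H]
  {G : Type*} [TopologicalSpace G] [ChartedSpace B G] [Group G]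
  {X : CentralLieCrossedModule (E := E) (F := F) (B := B) Gt H G}

namespace ConnectiveStructure

/-- Every morphism of connective structures is invertible, with inverse the opposite form. -/
def isoOfHom {c₁ c₂ : X.ConnectiveStructure} (σ : c₁ ⟶ c₂) : c₁ ≅ c₂ where
  hom := σ
  inv :=
    { form := -σ.form
      isConnection := by
        rw [pullback_neg, pullback_neg, ← neg_sub, σ.isConnection]
        abel
      square := by
        rw [pullback_neg, pullback_neg, pullback_neg, ← sub_eq_add_neg, sub_eq_iff_eq_add,
          add_assoc, σ.square]
        abel }
  hom_inv_id := Iso.ext (add_neg_cancel σ.form)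
  inv_hom_id := Iso.ext (neg_add_cancel σ.form)

/-- The connective structure obtained from `c` by adding the coboundary of a 1-form on `Gt`. -/
def twist (c : X.ConnectiveStructure) (σ : OneForm 𝓘(ℝ, E) Gt X.lieT) :
    X.ConnectiveStructure where
  conn := c.conn + (pullback X.tgt σ - pullback X.src σ)
  conn_translate t ht := by
    have h₁ : pullback (X.translate t) (pullback X.tgt σ) = pullback X.tgt σ := by
      have e : X.tgt.comp (X.translate t) = X.tgt := ContMDiffMap.ext fun p => by
        change X.f (p.2 * t) * p.1 = X.f p.2 * p.1
        rw [map_mul, MonoidHom.mem_ker.1 ht, mul_one]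
      rw [pullback_pullback, e]
    have h₂ : pullback (X.translate t) (pullback X.src σ) = pullback X.src σ :=
      pullback_pullback X.src (X.translate t) σ
    rw [pullback_add, pullback_sub, c.conn_translate t ht, h₁, h₂]
  conn_fundamental p u := by
    have hu : X.df (u : F) = 0 := u.2
    refine (X.coord_pullback_orbit p _ u).trans ?_
    rw [coeffSnd_apply, coord_add, coord_sub, X.coord_pullback_tgt, X.coord_pullback_src,
      theta_leftTranslation, hu, map_zero, map_zero, map_zero, add_zero, map_zero, sub_zero,
      add_zero, ← coeffSnd_apply, ← X.coord_pullback_orbit]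
    exact c.conn_fundamental p u
  conn_gerbeProd := by
    have h₁ : pullback X.gerbeProd (pullback X.tgt σ) = pullback X.pairSnd (pullback X.tgt σ) :=
      pullback_pullback_congr (fun p => (X.gerbeProd_covers p).2.2) σ
    have h₂ : pullback X.gerbeProd (pullback X.src σ) = pullback X.pairFst (pullback X.src σ) :=
      pullback_pullback_congr (fun _ => by rfl) σ
    have h₃ : pullback X.pairFst (pullback X.tgt σ) = pullback X.pairSnd (pullback X.src σ) :=
      pullback_pullback_congr (fun _ => by rfl) σ
    rw [pullback_add, pullback_add, pullback_add, pullback_sub, pullback_sub, pullback_sub,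
      c.conn_gerbeProd, h₁, h₂, h₃]
    abel
  mConn := c.mConn + (pullback X.face₁₂ σ - (pullback X.face₁ σ + pullback X.face₂ σ))
  mConn_isConnection := by
    have h₁ : pullback X.tgt₂ (pullback X.face₁₂ σ) = pullback X.mulL (pullback X.tgt σ) :=
      pullback_pullback_congr (fun p => (X.mulL_covers p).2.symm) σ
    have h₂ : pullback X.src₂ (pullback X.face₁₂ σ) = pullback X.mulL (pullback X.src σ) :=
      pullback_pullback_congr (fun _ => by rfl) σ
    have h₃ : pullback X.tgt₂ (pullback X.face₁ σ) = pullback X.fstL (pullback X.tgt σ) :=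
      pullback_pullback_congr (fun _ => by rfl) σ
    have h₄ : pullback X.src₂ (pullback X.face₁ σ) = pullback X.fstL (pullback X.src σ) :=
      pullback_pullback_congr (fun _ => by rfl) σ
    have h₅ : pullback X.tgt₂ (pullback X.face₂ σ) = pullback X.sndL (pullback X.tgt σ) :=
      pullback_pullback_congr (fun _ => by rfl) σ
    have h₆ : pullback X.src₂ (pullback X.face₂ σ) = pullback X.sndL (pullback X.src σ) :=
      pullback_pullback_congr (fun _ => by rfl) σ
    have e := c.mConn_isConnection
    rw [sub_eq_iff_eq_add] at e
    simp only [pullback_add, pullback_sub, e, h₁, h₂, h₃, h₄, h₅, h₆]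
    abel
  assoc_flat := by
    have h₁ : pullback X.face_1_2 (pullback X.face₁₂ σ) =
        pullback X.face_12_3 (pullback X.face₁ σ) :=
      pullback_pullback_congr (fun _ => by rfl) σ
    have h₂ : pullback X.face_12_3 (pullback X.face₁₂ σ) =
        pullback X.face_1_23 (pullback X.face₁₂ σ) :=
      pullback_pullback_congr (fun p => mul_assoc p.1 p.2.1 p.2.2) σ
    have h₃ : pullback X.face_1_2 (pullback X.face₁ σ) =
        pullback X.face_1_23 (pullback X.face₁ σ) :=
      pullback_pullback_congr (fun _ => by rfl) σ
    have h₄ : pullback X.face_1_2 (pullback X.face₂ σ) = pullback X.face_2_3 (pullback X.face₁ σ) :=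
      pullback_pullback_congr (fun _ => by rfl) σ
    have h₅ : pullback X.face_12_3 (pullback X.face₂ σ) =
        pullback X.face_2_3 (pullback X.face₂ σ) :=
      pullback_pullback_congr (fun _ => by rfl) σ
    have h₆ : pullback X.face_1_23 (pullback X.face₂ σ) =
        pullback X.face_2_3 (pullback X.face₁₂ σ) :=
      pullback_pullback_congr (fun _ => by rfl) σ
    have e := c.assoc_flat
    rw [← sub_eq_zero] at e ⊢
    rw [← e]
    simp only [pullback_add, pullback_sub, h₁, h₂, h₃, h₄, h₅, h₆]
    abel

/-- The 1-form `σ` is an isomorphism from `c` to its twist by `σ`. -/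
def homTwist (c : X.ConnectiveStructure) (σ : OneForm 𝓘(ℝ, E) Gt X.lieT) : c ⟶ c.twist σ where
  form := σ
  isConnection := by
    change c.conn + (pullback X.tgt σ - pullback X.src σ) - c.conn = _
    abel
  square := by
    change _ = _ + (c.mConn + (pullback X.face₁₂ σ - (pullback X.face₁ σ + pullback X.face₂ σ)))
    abel

theorem coeffSnd_mConn_twist (c : X.ConnectiveStructure) (σ : OneForm 𝓘(ℝ, E) Gt X.lieT)
    (g₁ g₂ : Gt) (v : E) : (c.twist σ).mConn.coeffSnd (g₁, g₂) v =
      c.mConn.coeffSnd (g₁, g₂) v + (σ.coeff (g₁ * g₂) v - σ.coeff g₂ v) := by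
  change (c.mConn + (pullback X.face₁₂ σ -
    (pullback X.face₁ σ + pullback X.face₂ σ))).coeffSnd (g₁, g₂) v = _
  simp only [coeffSnd_apply, coord_add, coord_sub, X.coord_pullback_face₁₂,
    X.coord_pullback_face₁, X.coord_pullback_face₂, theta_leftTranslation, map_zero, zero_add]

/-- The component along the second factor is a coboundary: evaluate the flatness of the associator
at `(g₁, g₂, 1)` on tangent vectors to the third factor. -/
theorem coeffSnd_mConn_eq_sub (c : X.ConnectiveStructure) (g₁ g₂ : Gt) (v : E) :
    c.mConn.coeffSnd (g₁, g₂) v =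
      c.mConn.coeffSnd (g₁ * g₂, 1) v - c.mConn.coeffSnd (g₂, 1) v := by
  have e := (X.assoc_flat_iff _).1 c.assoc_flat g₁ g₂ 1 0 0 v
  simp only [map_zero, zero_add, mul_one] at e
  exact eq_sub_of_add_eq e.symm

/-- A connective structure is normalized if the connection on the multiplication vanishes on tangent
vectors to the second factor. -/
def IsNormalized (c : X.ConnectiveStructure) : Prop := ∀ p, c.mConn.coeffSnd p = 0

/-- The 1-form on `Gt` with coefficient minus the second coefficient at `(g, 1)` of the connection
on the multiplication. Twisting by it removes the second coefficient at every point. -/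
def normalizingForm [FiniteDimensional ℝ E] (c : X.ConnectiveStructure) :
    OneForm 𝓘(ℝ, E) Gt X.lieT :=
  (maurerCartan E Gt).clmComp (fun g => -c.mConn.coeffSnd (g, 1))
    ((contMDiff_coeffSnd c.mConn).comp (contMDiff_id.prodMk contMDiff_const)).neg

theorem isNormalized_twist [FiniteDimensional ℝ E] (c : X.ConnectiveStructure) :
    (c.twist c.normalizingForm).IsNormalized := by
  rintro ⟨g₁, g₂⟩
  ext1 v
  rw [coeffSnd_mConn_twist, normalizingForm, coeff_clmComp_maurerCartan,
    coeff_clmComp_maurerCartan, coeffSnd_mConn_eq_sub, neg_apply, neg_apply, zero_apply]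
  abel

namespace IsNormalized

variable {c : X.ConnectiveStructure}

/-- The connection on the multiplication is invariant under left translations of the first
factor. -/
theorem coeffFst_mConn (hc : c.IsNormalized) (g₁ g₂ : Gt) :
    c.mConn.coeffFst (g₁, g₂) = c.mConn.coeffFst (1, g₂) := by
  ext1 v
  have e := (X.assoc_flat_iff _).1 c.assoc_flat g₁ 1 g₂ 0 v 0
  simpa only [map_zero, zero_add, mul_one, hc _, zero_apply, add_zero] using e

/-- The cocycle identity for `κ(g) = c.mConn.coeffFst (1, g)`. -/
theorem coeffFst_mConn_mul (hc : c.IsNormalized) (g₁ g₂ : Gt) (v : E) :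
    c.mConn.coeffFst (1, g₁ * g₂) v =
      c.mConn.coeffFst (1, g₂) (lieAd g₁⁻¹ v) + c.mConn.coeffFst (1, g₁) v := by
  have e := (X.assoc_flat_iff _).1 c.assoc_flat 1 g₁ g₂ v 0 0
  simp only [map_zero, one_mul, hc _, add_zero] at e
  rw [hc.coeffFst_mConn g₁ g₂] at e
  rw [← e, add_comm]

/-- The connection on `L` vanishes on tangent vectors to `Gt`: the condition on the multiplication
shows that its first coefficient does not depend on `h`, and flatness of the gerbe product that it
vanishes at `h = 1`. -/
theorem coeffFst_conn (hc : c.IsNormalized) (p : Gt × H) : c.conn.coeffFst p = 0 := by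
  obtain ⟨g, h⟩ := p
  ext1 v
  have e := (X.mConn_isConnection_iff _ _).1 c.mConn_isConnection 1 g h 1 0 v 0 0
  simp only [map_zero, one_mul, mul_one, map_one, hc _, zero_apply, add_zero, zero_add,
    sub_zero] at e
  have e' := (X.gerbeProd_flat_iff _).1 c.conn_gerbeProd g 1 1 v 0 0
  simp only [map_zero, one_mul, map_one, add_zero, zero_add] at e'
  rw [zero_apply, sub_eq_zero.1 e.symm, left_eq_add.1 e']

theorem coeffSnd_conn_dact (hc : c.IsNormalized) (g : Gt) (h : H) (u : F) :
    c.conn.coeffSnd (g, h) (X.dact g u) = c.conn.coeffSnd (1, 1) u := by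
  have e := (X.mConn_isConnection_iff _ _).1 c.mConn_isConnection g 1 h 1 0 0 0 u
  simp only [map_zero, mul_one, map_one, hc _, zero_apply, add_zero, zero_add,
    sub_zero] at e
  exact (sub_eq_zero.1 e.symm)

theorem coeffSnd_conn (hc : c.IsNormalized) (g : Gt) (h : H) (u : F) :
    c.conn.coeffSnd (g, h) u = c.conn.coeffSnd (1, 1) (X.dact g⁻¹ u) := by
  rw [← hc.coeffSnd_conn_dact g h, ← X.dact_mul, mul_inv_cancel, X.dact_one]

/-- The strong adjustment of a normalized connective structure. -/
def toStrongAdjustment [FiniteDimensional ℝ E] (hc : c.IsNormalized) : X.StrongAdjustment where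
  s := c.conn.coeffSnd (1, 1)
  s_splits u := (X.coord_pullback_orbit _ _ _).symm.trans (c.conn_fundamental (1, 1) u)
  κ g := c.mConn.coeffFst (1, g)
  smooth_κ := (contMDiff_coeffFst c.mConn).comp (contMDiff_const.prodMk contMDiff_id)
  κ_mul g₁ g₂ v := hc.coeffFst_mConn_mul g₁ g₂ v
  κ_f h v := by
    have e := (X.mConn_isConnection_iff _ _).1 c.mConn_isConnection 1 1 1 h v 0 0 0
    have e₁ := hc.coeffFst_mConn_mul 1 1 v
    rw [mul_one, inv_one, lieAd_one, left_eq_add] at e₁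
    simp only [map_zero, mul_one, one_mul, map_one, hc _, zero_apply, add_zero, zero_add,
      sub_zero, hc.coeffFst_conn, X.dact_one, MulAut.one_apply, e₁] at e
    rw [e, hc.coeffSnd_conn, inv_one, X.dact_one]
  κ_df g u := by
    have e := (X.mConn_isConnection_iff _ _).1 c.mConn_isConnection 1 g 1 1 0 0 u 0
    simp only [map_zero, mul_one, one_mul, map_one, hc _, add_zero, zero_add,
      sub_zero, inv_one, lieAd_one] at e
    rw [e, hc.coeffSnd_conn, map_sub]

theorem conn_eq [FiniteDimensional ℝ E] (hc : c.IsNormalized) :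
    hc.toStrongAdjustment.conn = c.conn :=
  ext_coeff₂
    (fun p => by rw [StrongAdjustment.coeffFst_conn, hc.coeffFst_conn])
    (fun p => by
      ext1 u
      rw [StrongAdjustment.coeffSnd_conn, StrongAdjustment.connCoeff_apply]
      exact (hc.coeffSnd_conn p.1 p.2 u).symm)

theorem mConn_eq [FiniteDimensional ℝ E] (hc : c.IsNormalized) :
    hc.toStrongAdjustment.mConn = c.mConn :=
  ext_coeff₂
    (fun p => by
      rw [StrongAdjustment.coeffFst_mConn]
      exact (hc.coeffFst_mConn p.1 p.2).symm)
    (fun p => by rw [StrongAdjustment.coeffSnd_mConn, hc p])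

/-- The zero form is an isomorphism from the connective structure of the adjustment of `c` to `c`,
as both have the same connections. -/
def hom [FiniteDimensional ℝ E] (hc : c.IsNormalized) :
    hc.toStrongAdjustment.toConnectiveStructure ⟶ c where
  form := 0
  isConnection := by
    rw [StrongAdjustment.toConnectiveStructure_conn, hc.conn_eq]
    simp
  square := by
    rw [StrongAdjustment.toConnectiveStructure_mConn, hc.mConn_eq]
    simp

end IsNormalized

end ConnectiveStructure

instance [FiniteDimensional ℝ E] : (StrongAdjustment.toConnectiveStructureFunctor X).EssSurj where
  mem_essImage c :=
    ⟨c.isNormalized_twist.toStrongAdjustment,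
      ⟨(ConnectiveStructure.isoOfHom c.isNormalized_twist.hom).trans
        (ConnectiveStructure.isoOfHom (c.homTwist c.normalizingForm)).symm⟩⟩

end CentralLieCrossedModule

end

/-! ### The equivalence -/

theorem mainTheorem8
    {E : Type*} [NormedAddCommGroup E] [NormedSpace ℝ E] [FiniteDimensional ℝ E]
    {F : Type*} [NormedAddCommGroup F] [NormedSpace ℝ F] [FiniteDimensional ℝ F]
    {B : Type*} [NormedAddCommGroup B] [NormedSpace ℝ B] [FiniteDimensional ℝ B]
    {Gt : Type*} [TopologicalSpace Gt] [T2Space Gt] [SecondCountableTopology Gt]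
    [ChartedSpace E Gt] [Group Gt] [LieGroup 𝓘(ℝ, E) ∞ Gt]
    {H : Type*} [TopologicalSpace H] [T2Space H] [SecondCountableTopology H]
    [ChartedSpace F H] [Group H] [LieGroup 𝓘(ℝ, F) ∞ H]
    {G : Type*} [TopologicalSpace G] [T2Space G] [SecondCountableTopology G]
    [ChartedSpace B G] [Group G] [LieGroup 𝓘(ℝ, B) ∞ G]
    (X : CentralLieCrossedModule (E := E) (F := F) (B := B) Gt H G) :
    Nonempty (X.ConnectiveStructure ≌ X.StrongAdjustment) := by
  have : (CentralLieCrossedModule.StrongAdjustment.toConnectiveStructureFunctor X).IsEquivalence :=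
    {}
  exact ⟨(CentralLieCrossedModule.StrongAdjustment.toConnectiveStructureFunctor
    X).asEquivalence.symm⟩
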